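/- Let $p$ be a prime, $k=\mathbb F_{p^2}$ and $A=k[[x]]$. For $f=\sum c_ix^i\in A$ write $f^{(p^r)}=\sum c_i^{p^r}x^i$. For $r\ge 0$ put $$F_{p^r}(x,y)=\prod_{i+j=r}\bigl(x^{p^i}-y^{p^j}\bigr),\qquad A_r=k[[x_0,x_1]]/(F_{p^r}(x_0,x_1)),$$ with the ring homomorphisms $s,t\colon A\to A_r$, $s(f(x))=f(x_0)$ and $t(f(x))=f^{(p^r)}(x_1)$. (This is the ring of subgroup schemes of order $p^r$ of the universal deformation, to rings of characteristic $p$, of a supersingular elliptic curve over $\mathbb F_{p^2}$ with $F^2=[-p]$; $s$ and $t$ classify the curve and its quotient.) Regard $A_r$ as an $A$-bimodule, on the left through $s$ and on the right through $t$, and let $u_1\colon A_{r+r'}\to A_r\otimes_A A_{r'}$ be the ring homomorphism with $s(a)\mapsto s(a)\otimes 1$ and $x_1\mapsto 1\otimes x_1$, where $A_r\otimes_A A_{r'}\cong k[[x_0,x_1,x_2]]/(F_{p^r}(x_0,x_1),F_{p^{r'}}(x_1,x_2))$. Let $\Gamma_r=\operatorname{Hom}_A(A_r,A)$ be the set of left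 $A$-linear maps, with the $A$-bimodule structure $(a\cdot\phi\cdot b)(m)=\phi(s(a)\,m\,t(b))$. The product $\Gamma_r\times\Gamma_{r'}\to\Gamma_{r+r'}$ dual to $u_1$, namely $(\phi\psi)(g)=(\phi\otimes\psi)(u_1(g))$ with $(\phi\otimes\psi)(m\otimes n)=\phi(m\,t(\psi(n)))$, makes $\Gamma=\bigoplus_{r\ge0}\Gamma_r$ a graded associative ring with $\Gamma_0\cong A$ (not central). Let $P_0,\dots,P_p\in\Gamma_1$ be the left $A$-basis dual to the basis $1,x_1,\dots,x_1^p$ of $A_1$. Let $T\Gamma_1=\bigoplus_{r\ge0}\Gamma_1^{\otimes_A r}$ be the tensor algebra on the $A$-bimodule $\Gamma_1$, and let $\Delta$ be its quotient by the two-sided ideal generated by the elements $\sum_{j=0}^p x^j\,P_iP_j$ for $i=1,\dots,p$. Let $\Delta_r\subseteq\Delta$ be the image of $\Gamma_1^{\otimes_A r}$. Then: 1. There is an isomorphism of rings $\zeta\colon\Delta\to\Gamma$ that is the identity on $A$ (that is, $\zeta(a)=a\cdot 1$) and on $\Gamma_1$, and $\zeta(\Delta_r)=\Gamma_r$ for all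 $r\ge 0$. 2. Call a sequence $I=(i_1,\dots,i_r)$ of elements of $\{0,\dots,p\}$ admissible if there is no $l$ with $i_l\ne0$ and $i_{l+1}=0$. For every $r\ge0$ the monomials $P_I=P_{i_1}\cdots P_{i_r}$, with $I$ admissible of length $r$, form a basis of $\Gamma_r$ as a left $A$-module, and there are $1+p+\cdots+p^r$ admissible sequences of length $r$. -/

import Mathlib

set_option linter.unusedSectionVars false

open scoped TensorProduct PowerSeries DirectSum

namespace Isogeny

/-- The polynomial `F_{p^r}(x, y) = ∏_{i + j = r} (x ^ p ^ i - y ^ p ^ j)`, evaluated at two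
elements of a commutative ring. -/
def crossing {R : Type*} [CommRing R] (p r : ℕ) (x y : R) : R :=
  ∏ i ∈ Finset.range (r + 1), (x ^ p ^ i - y ^ p ^ (r - i))

theorem map_crossing {R S : Type*} [CommRing R] [CommRing S] (f : R →+* S) (p r : ℕ) (x y : R) :
    f (crossing p r x y) = crossing p r (f x) (f y) := by
  simp [crossing, map_prod]

section Crossing

open Polynomial

theorem monic_dvd_of_smul {K D : Type*} [CommRing K] [CommRing D] [Algebra K D]
    [Module.IsTorsionFree K D] [IsDomain K] {g h : D[X]} (hg : g.Monic) {c : K} (hc : c ≠ 0)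
    (hd : g ∣ C (algebraMap K D c) * h) : g ∣ h := by
  rw [← modByMonic_eq_zero_iff_dvd hg] at hd ⊢
  have h1 : C (algebraMap K D c) * h = algebraMap K D c • h := by
    rw [smul_eq_C_mul]
  rw [h1, smul_modByMonic] at hd
  ext n
  have h2 := congrArg (fun q : D[X] => q.coeff n) hd
  simp only [coeff_smul, coeff_zero, smul_eq_mul] at h2
  rw [← Algebra.smul_def] at h2
  simpa [hc] using (smul_eq_zero.mp h2)

theorem prod_dvd_of_coprimality {R : Type*} [CommRing R] (g : ℕ → R) (G : R) (n : ℕ)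
    (hreg : ∀ i < n, ∀ a b, g i * a = g i * b → a = b)
    (hrel : ∀ i < n, ∀ j < i, ∀ h, g j ∣ g i * h → g j ∣ h)
    (hG : ∀ i < n, g i ∣ G) : ∏ i ∈ Finset.range n, g i ∣ G := by
  induction n with
  | zero => simp
  | succ n ih =>
    have ih' := ih (fun i hi => hreg i (by omega)) (fun i hi => hrel i (by omega))
      (fun i hi => hG i (by omega))
    obtain ⟨h, hh⟩ := hG n (by omega)
    have key : ∀ m ≤ n, ∀ w, ∏ i ∈ Finset.range m, g i ∣ g n * w →
        ∏ i ∈ Finset.range m, g i ∣ w := by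
      intro m
      induction m with
      | zero => simp
      | succ m ihm =>
        intro hm w hw
        rw [Finset.prod_range_succ] at hw ⊢
        have h1 : g m ∣ w := hrel n (by omega) m (by omega) w ((Dvd.intro_left _ rfl).trans hw)
        obtain ⟨v, rfl⟩ := h1
        obtain ⟨u, hu⟩ := hw
        have h2 : g n * v = (∏ i ∈ Finset.range m, g i) * u :=
          hreg m (by omega) _ _ (by linear_combination hu)
        obtain ⟨v', hv'⟩ := ihm (by omega) v ⟨u, h2⟩
        exact ⟨v', by rw [hv']; ring⟩
    rw [hh] at ih'
    obtain ⟨v, hv⟩ := key n le_rfl h ih'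
    rw [Finset.prod_range_succ, hh, hv]
    exact ⟨v, by ring⟩

/-- The composition law for the polynomials `F_{p^r}` in characteristic `p`. -/
theorem crossing_comp {K T : Type*} [Field K] (p : ℕ) [hp : Fact p.Prime] [CharP K p] [CommRing T]
    (φ : K →+* T) (r s : ℕ) (x y z : T) (h1 : crossing p r x y = 0) (h2 : crossing p s y z = 0) :
    crossing p (r + s) x z = 0 := by
  classical
  -- the universal ring `D = K[y][z] / F_{p^s}(y, z)`
  set Q : K[X][X] := ∏ i ∈ Finset.range (s + 1), (X ^ p ^ (s - i) - C (X ^ p ^ i)) with hQ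
  have pp : ∀ n, p ^ n ≠ 0 := fun n => pow_ne_zero _ hp.out.ne_zero
  have hQm : Q.Monic := monic_prod_of_monic _ _ fun i _ => monic_X_pow_sub_C _ (pp _)
  let D := AdjoinRoot Q
  have hfree : Module.Free K[X] D := hQm.free_adjoinRoot
  have hQdeg : 0 < Q.natDegree := by
    rw [hQ, natDegree_prod_of_monic _ _ fun i _ => monic_X_pow_sub_C _ (pp _)]
    refine Finset.sum_pos (fun i _ => ?_) ⟨0, by simp⟩
    rw [natDegree_X_pow_sub_C]
    exact Nat.pos_of_ne_zero (pp _)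
  have hDnt : Nontrivial D := AdjoinRoot.nontrivial Q (by
    rw [degree_eq_natDegree hQm.ne_zero]; exact_mod_cast hQdeg.ne')
  have hchar : CharP D p := charP_of_injective_ringHom
    (f := (algebraMap K[X] D).comp (C : K →+* K[X])) (RingHom.injective _) p
  let Y : D := algebraMap K[X] D X
  let Z : D := AdjoinRoot.root Q
  have hYZ : crossing p s Y Z = 0 := by
    have : (AdjoinRoot.mk Q) Q = 0 := AdjoinRoot.mk_self
    rw [hQ, map_prod] at this
    have h3 : crossing p s Y Z = (-1) ^ (s + 1) *
        ∏ i ∈ Finset.range (s + 1), AdjoinRoot.mk Q (X ^ p ^ (s - i) - C (X ^ p ^ i)) := by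
      rw [crossing, ← Finset.card_range (s + 1), ← Finset.prod_const, Finset.card_range,
        ← Finset.prod_mul_distrib]
      refine Finset.prod_congr rfl fun i _ => ?_
      rw [map_sub, map_pow, map_pow, map_pow, AdjoinRoot.mk_X, AdjoinRoot.mk_C]
      change AdjoinRoot.of Q X ^ p ^ i - AdjoinRoot.root Q ^ p ^ (s - i) = _
      ring
    rw [h3, this, mul_zero]
  let g : ℕ → D[X] := fun i => X ^ p ^ i - C (Y ^ p ^ (r - i))
  have hgm : ∀ i, (g i).Monic := fun i => monic_X_pow_sub_C _ (pp _)
  have hdvd : ∏ i ∈ Finset.range (r + 1), g i ∣ crossing p (r + s) (X : D[X]) (C Z) := by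
    refine prod_dvd_of_coprimality g _ _ (fun i _ a b hab => (hgm i).isRegular.left hab) ?_ ?_
    · intro i hi j hj h hd
      have hred : g j ∣ g i - C (algebraMap K[X] D (X ^ p ^ (r - j + (i - j)) - X ^ p ^ (r - i))) := by
        have : g i - C (algebraMap K[X] D (X ^ p ^ (r - j + (i - j)) - X ^ p ^ (r - i)))
            = (X ^ p ^ j) ^ p ^ (i - j) - (C (Y ^ p ^ (r - j))) ^ p ^ (i - j) := by
          simp only [g, Y, map_sub, map_pow, ← pow_mul, ← pow_add]
          rw [Nat.add_sub_cancel' hj.le]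
          ring
        rw [this]
        exact sub_dvd_pow_sub_pow _ _ _
      have hd' : g j ∣ C (algebraMap K[X] D (X ^ p ^ (r - j + (i - j)) - X ^ p ^ (r - i))) * h := by
        have := dvd_sub hd (hred.mul_right h)
        convert this using 1
        ring
      refine monic_dvd_of_smul (hgm j) ?_ hd'
      intro h0
      rw [sub_eq_zero] at h0
      have := congrArg natDegree h0
      rw [natDegree_X_pow, natDegree_X_pow] at this
      have := Nat.pow_right_injective hp.out.two_le this
      omega
    · intro i hi
      -- modulo `g i`, the factors with index `i, …, i + s` multiply to a power of `F_{p^s}(Y, Z)`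
      have hsub : crossing p (r + s) (X : D[X]) (C Z) =
          (∏ j ∈ Finset.range (r + s + 1) \ Finset.image (fun l => i + l) (Finset.range (s + 1)),
            ((X : D[X]) ^ p ^ j - C Z ^ p ^ (r + s - j))) *
          ∏ l ∈ Finset.range (s + 1), ((X : D[X]) ^ p ^ (i + l) - C Z ^ p ^ (r + s - (i + l))) := by
        rw [crossing, ← Finset.prod_sdiff (s₁ := Finset.image (fun l => i + l) (Finset.range (s + 1)))]
        · rw [Finset.prod_image (by intro a _ b _ hab; simpa using hab)]
        · intro j hj
          simp only [Finset.mem_image, Finset.mem_range] at hj ⊢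
          omega
      rw [hsub]
      refine Dvd.dvd.mul_left ?_ _
      rw [← Ideal.mem_span_singleton, ← Ideal.Quotient.eq_zero_iff_mem]
      have hx : (Ideal.Quotient.mk (Ideal.span {g i}) X) ^ p ^ i =
          (Ideal.Quotient.mk (Ideal.span {g i}) (C Y)) ^ p ^ (r - i) := by
        rw [← sub_eq_zero, ← map_pow, ← map_pow, ← map_sub, Ideal.Quotient.eq_zero_iff_mem,
          Ideal.mem_span_singleton]
        simp [g]
      set π := Ideal.Quotient.mk (Ideal.span {g i})
      have hC : ∏ l ∈ Finset.range (s + 1),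
          (π (C Y) ^ p ^ l - π (C Z) ^ p ^ (s - l)) ^ p ^ (r - i) = 0 := by
        rw [Finset.prod_pow]
        have : ∏ l ∈ Finset.range (s + 1), (π (C Y) ^ p ^ l - π (C Z) ^ p ^ (s - l)) = 0 := by
          have := map_crossing (π.comp C) p s Y Z
          rw [hYZ, map_zero] at this
          exact this.symm
        rw [this, zero_pow (pp _)]
      rw [map_prod, ← hC]
      refine Finset.prod_congr rfl fun l hl => ?_
      have hl' : l < s + 1 := Finset.mem_range.mp hl
      have hexp : (π (C Y) ^ p ^ l - π (C Z) ^ p ^ (s - l)) ^ p ^ (r - i) =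
          (π (C Y) ^ p ^ l) ^ p ^ (r - i) - (π (C Z) ^ p ^ (s - l)) ^ p ^ (r - i) := by
        have := congrArg π (sub_pow_expChar_pow (n := r - i) (p := p)
          ((C Y : D[X]) ^ p ^ l) (C Z ^ p ^ (s - l)))
        simpa only [map_sub, map_pow] using this
      rw [hexp, map_sub, map_pow, map_pow]
      rw [pow_add p i l, pow_mul, hx, ← pow_mul, ← pow_mul, ← pow_mul, ← pow_add, ← pow_add,
        ← pow_add]
      congr 3
      · ring
      · omega
  obtain ⟨W, hW⟩ := hdvd
  let f0 : K[X] →+* T := eval₂RingHom φ y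
  have hf0 : Q.eval₂ f0 z = 0 := by
    have h3 : Q.eval₂ f0 z = (-1) ^ (s + 1) * crossing p s y z := by
      rw [hQ, eval₂_finsetProd, crossing, ← Finset.card_range (s + 1), ← Finset.prod_const,
        Finset.card_range, ← Finset.prod_mul_distrib]
      refine Finset.prod_congr rfl fun i _ => ?_
      rw [eval₂_sub, eval₂_pow, eval₂_X, eval₂_C, map_pow]
      simp only [f0, coe_eval₂RingHom, eval₂_X]
      ring
    rw [h3, h2, mul_zero]
  let f1 : D →+* T := AdjoinRoot.lift f0 z hf0
  let f2 : D[X] →+* T := eval₂RingHom f1 x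
  have hX : f2 X = x := by simp [f2]
  have hY : f2 (C Y) = y := by
    simp only [f2, coe_eval₂RingHom, eval₂_C]
    exact (AdjoinRoot.lift_of hf0).trans (by simp [f0])
  have hZ : f2 (C Z) = z := by
    simp only [f2, coe_eval₂RingHom, eval₂_C]
    exact AdjoinRoot.lift_root hf0
  have h4 := congrArg f2 hW
  rw [map_crossing, hX, hZ, map_mul] at h4
  have h5 : f2 (∏ i ∈ Finset.range (r + 1), g i) = 0 := by
    rw [map_prod, ← h1, crossing]
    refine Finset.prod_congr rfl fun i _ => ?_
    simp only [g, map_sub, map_pow, hX, hY]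
  rw [h4, h5, zero_mul]

end Crossing

/-- For a distinguished polynomial `g`, the rings `A[X] / (g)` and `A⟦X⟧ / (g)` agree. -/
noncomputable def weierstrassEquiv {A : Type*} [CommRing A] {I : Ideal A} [IsAdicComplete I A]
    {g : Polynomial A} (H : g.IsDistinguishedAt I) :
    (Polynomial A ⧸ Ideal.span {g}) ≃+* (A⟦X⟧ ⧸ Ideal.span {(g : A⟦X⟧)}) :=
  H.algEquivQuotient.toRingEquiv

theorem weierstrassEquiv_mk {A : Type*} [CommRing A] {I : Ideal A} [IsAdicComplete I A]
    {g : Polynomial A} (H : g.IsDistinguishedAt I) (f : Polynomial A) :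
    weierstrassEquiv H (Ideal.Quotient.mk _ f) = Ideal.Quotient.mk _ (f : A⟦X⟧) := by
  change H.algEquivQuotient (Ideal.Quotient.mk _ f) = _
  simp

section IsogRing

variable (p : ℕ) (k : Type*) [Field k]

/-- The ring `A_r = k⟦x₀, x₁⟧ / (F_{p^r}(x₀, x₁))`, where `k⟦x₀, x₁⟧` is written as
`k⟦x₀⟧⟦x₁⟧`: the outer variable is `x₁` and `x₀` is a constant. -/
def IsogRing (r : ℕ) : Type _ :=
  k⟦X⟧⟦X⟧ ⧸ Ideal.span
    {crossing p r (PowerSeries.C (PowerSeries.X : k⟦X⟧)) (PowerSeries.X : k⟦X⟧⟦X⟧)}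

noncomputable instance (r : ℕ) : CommRing (IsogRing p k r) :=
  inferInstanceAs (CommRing (k⟦X⟧⟦X⟧ ⧸ Ideal.span
    {crossing p r (PowerSeries.C (PowerSeries.X : k⟦X⟧)) (PowerSeries.X : k⟦X⟧⟦X⟧)}))

/-- The quotient map `k⟦x₀, x₁⟧ → A_r`. -/
noncomputable def IsogRing.mk (r : ℕ) : k⟦X⟧⟦X⟧ →+* IsogRing p k r := Ideal.Quotient.mk _

/-- The source map `s : A → A_r`, `s (f(x)) = f(x₀)`. -/
noncomputable def IsogRing.source (r : ℕ) : k⟦X⟧ →+* IsogRing p k r :=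
  (IsogRing.mk p k r).comp PowerSeries.C

/-- `A_r` is an `A`-algebra, in particular a left `A`-module, through `s`. -/
noncomputable instance (r : ℕ) : Algebra k⟦X⟧ (IsogRing p k r) :=
  (IsogRing.source p k r).toAlgebra

/-- The class of `x₁` in `A_r`. -/
noncomputable def IsogRing.x₁ (r : ℕ) : IsogRing p k r := IsogRing.mk p k r PowerSeries.X

theorem crossing_x₁ (r : ℕ) :
    crossing p r (algebraMap k⟦X⟧ (IsogRing p k r) PowerSeries.X) (IsogRing.x₁ p k r) = 0 := by
  have h := map_crossing (IsogRing.mk p k r) p r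
    (PowerSeries.C (PowerSeries.X : k⟦X⟧)) (PowerSeries.X : k⟦X⟧⟦X⟧)
  have h0 : IsogRing.mk p k r
      (crossing p r (PowerSeries.C (PowerSeries.X : k⟦X⟧)) PowerSeries.X) = 0 :=
    Ideal.Quotient.eq_zero_iff_mem.mpr (Ideal.mem_span_singleton_self _)
  rw [h0] at h
  exact h.symm

/-- `F_{p^r}(x₀, x₁)` up to sign, as a monic polynomial in `x₁` with coefficients in `k⟦x₀⟧`. -/
noncomputable def crossingPoly (r : ℕ) : Polynomial k⟦X⟧ :=
  ∏ i ∈ Finset.range (r + 1),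
    (Polynomial.X ^ p ^ (r - i) - Polynomial.C (PowerSeries.X ^ p ^ i))

theorem neg_one_pow_mul_crossing {R : Type*} [CommRing R] (r : ℕ) (x y : R) :
    ∏ i ∈ Finset.range (r + 1), (y ^ p ^ (r - i) - x ^ p ^ i) =
      (-1) ^ (r + 1) * crossing p r x y := by
  rw [crossing, ← Finset.card_range (r + 1), ← Finset.prod_const,
    Finset.card_range, ← Finset.prod_mul_distrib]
  exact Finset.prod_congr rfl fun i _ => by ring

theorem coe_crossingPoly (r : ℕ) :
    ((crossingPoly p k r : Polynomial k⟦X⟧) : k⟦X⟧⟦X⟧) = (-1) ^ (r + 1) *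
      crossing p r (PowerSeries.C (PowerSeries.X : k⟦X⟧)) (PowerSeries.X : k⟦X⟧⟦X⟧) := by
  rw [← neg_one_pow_mul_crossing, crossingPoly]
  have := map_prod (Polynomial.coeToPowerSeries.ringHom (R := k⟦X⟧))
    (fun i => (Polynomial.X ^ p ^ (r - i) - Polynomial.C ((PowerSeries.X : k⟦X⟧) ^ p ^ i)))
    (Finset.range (r + 1))
  rw [Polynomial.coeToPowerSeries.ringHom_apply] at this
  rw [this]
  refine Finset.prod_congr rfl fun i _ => ?_
  simp

variable [hp : Fact p.Prime]

theorem crossingPoly_distinguished (r : ℕ) :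
    (crossingPoly p k r).IsDistinguishedAt (Ideal.span {(PowerSeries.X : k⟦X⟧)}) := by
  have pp : ∀ n, p ^ n ≠ 0 := fun n => pow_ne_zero _ hp.out.ne_zero
  have hf : ∀ i, (Polynomial.X ^ p ^ (r - i) - Polynomial.C ((PowerSeries.X : k⟦X⟧) ^ p ^ i) :
      Polynomial k⟦X⟧).IsDistinguishedAt (Ideal.span {(PowerSeries.X : k⟦X⟧)}) := by
    intro i
    refine ⟨⟨fun {n} hn => ?_⟩, Polynomial.monic_X_pow_sub_C _ (pp _)⟩
    rw [Polynomial.natDegree_X_pow_sub_C] at hn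
    rw [Polynomial.coeff_sub, Polynomial.coeff_X_pow, if_neg hn.ne, Polynomial.coeff_C, zero_sub,
      Ideal.neg_mem_iff]
    split_ifs
    · exact Ideal.pow_mem_of_mem _ (Ideal.mem_span_singleton_self _) _
        (Nat.pos_of_ne_zero (pp _))
    · exact Ideal.zero_mem _
  rw [crossingPoly]
  induction r + 1 with
  | zero =>
    refine ⟨⟨fun {n} hn => ?_⟩, by simp⟩
    simp at hn
  | succ n ih =>
    rw [Finset.prod_range_succ]
    exact ih.mul (hf n)

theorem crossingPoly_natDegree (r : ℕ) :
    (crossingPoly p k r).natDegree = ∑ i ∈ Finset.range (r + 1), p ^ i := by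
  have pp : ∀ n, p ^ n ≠ 0 := fun n => pow_ne_zero _ hp.out.ne_zero
  rw [crossingPoly, Polynomial.natDegree_prod_of_monic _ _
    fun i _ => Polynomial.monic_X_pow_sub_C _ (pp _), ← Finset.sum_range_reflect]
  refine Finset.sum_congr rfl fun i hi => ?_
  rw [Polynomial.natDegree_X_pow_sub_C]
  have : i < r + 1 := Finset.mem_range.mp hi
  congr 1
  omega

/-- `A_r` as a quotient of a polynomial ring (Weierstrass preparation). -/
noncomputable def isogRingEquiv (r : ℕ) :
    AdjoinRoot (crossingPoly p k r) ≃+* IsogRing p k r :=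
  (weierstrassEquiv (crossingPoly_distinguished p k r)).trans
    (Ideal.quotEquivOfEq (by
      rw [coe_crossingPoly]
      exact Ideal.span_singleton_mul_left_unit (IsUnit.pow _ isUnit_one.neg) _))

theorem isogRingEquiv_mk (r : ℕ) (f : Polynomial k⟦X⟧) :
    isogRingEquiv p k r (AdjoinRoot.mk _ f) = IsogRing.mk p k r (f : k⟦X⟧⟦X⟧) := by
  have : isogRingEquiv p k r (AdjoinRoot.mk _ f) = Ideal.quotEquivOfEq (by
      rw [coe_crossingPoly]
      exact Ideal.span_singleton_mul_left_unit (IsUnit.pow _ isUnit_one.neg) _)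
      (weierstrassEquiv (crossingPoly_distinguished p k r) (Ideal.Quotient.mk _ f)) := rfl
  rw [this, weierstrassEquiv_mk]
  rfl

theorem isogRingEquiv_root (r : ℕ) :
    isogRingEquiv p k r (AdjoinRoot.root _) = IsogRing.x₁ p k r := by
  rw [← AdjoinRoot.mk_X, isogRingEquiv_mk, Polynomial.coe_X]
  rfl

theorem isogRingEquiv_of (r : ℕ) (a : k⟦X⟧) :
    isogRingEquiv p k r (AdjoinRoot.of _ a) = algebraMap _ _ a := by
  rw [← AdjoinRoot.mk_C, isogRingEquiv_mk, Polynomial.coe_C]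
  rfl

/-- `isogRingEquiv` is an isomorphism of `A`-algebras. -/
noncomputable def isogAlgEquiv (r : ℕ) :
    AdjoinRoot (crossingPoly p k r) ≃ₐ[k⟦X⟧] IsogRing p k r :=
  AlgEquiv.ofRingEquiv (f := isogRingEquiv p k r) (isogRingEquiv_of p k r)

/-- The basis `1, x₁, x₁ ^ 2, …` of `A_r` as a (left) `A`-module, with `1 + p + ⋯ + p ^ r`
elements. -/
noncomputable def IsogRing.basis (r : ℕ) :
    Module.Basis (Fin (∑ i ∈ Finset.range (r + 1), p ^ i)) k⟦X⟧ (IsogRing p k r) :=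
  ((AdjoinRoot.powerBasis' (crossingPoly_distinguished p k r).monic).basis.map
    (isogAlgEquiv p k r).toLinearEquiv).reindex (finCongr (crossingPoly_natDegree p k r))

theorem IsogRing.basis_apply (r : ℕ) (i : Fin (∑ i ∈ Finset.range (r + 1), p ^ i)) :
    IsogRing.basis p k r i = IsogRing.x₁ p k r ^ (i : ℕ) := by
  simp only [IsogRing.basis, Module.Basis.reindex_apply, Module.Basis.map_apply,
    PowerBasis.basis_eq_pow, AdjoinRoot.powerBasis'_gen, AlgEquiv.toLinearEquiv_apply, map_pow]
  congr 1
  exact isogRingEquiv_root p k r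

/-- The ring homomorphism out of `A_r` that extends `σ : A → B` along `s` and sends `x₁` to `b`
(it exists if `F_{p^r}(σ x, b) = 0`, and it is unique because `A_r` is spanned over `A` by
powers of `x₁`). -/
noncomputable def IsogRing.lift {B : Type*} [CommRing B] (r : ℕ) (σ : k⟦X⟧ →+* B) (b : B)
    (h : crossing p r (σ PowerSeries.X) b = 0) : IsogRing p k r →+* B :=
  (AdjoinRoot.lift σ b (by
    have := neg_one_pow_mul_crossing p r (σ PowerSeries.X) b
    rw [h, mul_zero] at this
    rw [crossingPoly, Polynomial.eval₂_finsetProd, ← this]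
    exact Finset.prod_congr rfl fun i _ => by
      rw [Polynomial.eval₂_sub, Polynomial.eval₂_pow, Polynomial.eval₂_X, Polynomial.eval₂_C,
        map_pow])).comp
    ((isogRingEquiv p k r).symm : IsogRing p k r →+* AdjoinRoot (crossingPoly p k r))

variable {p k} in
theorem IsogRing.lift_algebraMap {B : Type*} [CommRing B] {r : ℕ} {σ : k⟦X⟧ →+* B} {b : B}
    (h : crossing p r (σ PowerSeries.X) b = 0) (a : k⟦X⟧) :
    IsogRing.lift p k r σ b h (algebraMap _ _ a) = σ a := by
  simp only [IsogRing.lift, RingHom.comp_apply, RingHom.coe_coe, ← isogRingEquiv_of,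
    RingEquiv.symm_apply_apply]
  exact AdjoinRoot.lift_of _

variable {p k} in
theorem IsogRing.lift_x₁ {B : Type*} [CommRing B] {r : ℕ} {σ : k⟦X⟧ →+* B} {b : B}
    (h : crossing p r (σ PowerSeries.X) b = 0) :
    IsogRing.lift p k r σ b h (IsogRing.x₁ p k r) = b := by
  simp only [IsogRing.lift, RingHom.comp_apply, RingHom.coe_coe, ← isogRingEquiv_root,
    RingEquiv.symm_apply_apply]
  exact AdjoinRoot.lift_root _

variable [CharP k p]

/-- The target map `t : A → A_r`, `t (f(x)) = f^{(p^r)}(x₁)`, where `f^{(p^r)}` is obtained from `f`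
by raising all coefficients to the power `p ^ r`. -/
noncomputable def IsogRing.target (r : ℕ) : k⟦X⟧ →+* IsogRing p k r :=
  (IsogRing.mk p k r).comp
    (PowerSeries.map ((PowerSeries.C : k →+* k⟦X⟧).comp (iterateFrobenius k p r)))

theorem target_X (r : ℕ) : IsogRing.target p k r PowerSeries.X = IsogRing.x₁ p k r := by
  simp [IsogRing.target, IsogRing.x₁]

theorem target_C (r : ℕ) (c : k) : IsogRing.target p k r (PowerSeries.C c) =
    algebraMap k⟦X⟧ _ (PowerSeries.C (c ^ p ^ r)) := by
  rw [RingHom.algebraMap_toAlgebra]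
  simp [IsogRing.target, IsogRing.source, iterateFrobenius_def]

/-- The ring `A_r`, regarded as an `A`-algebra through the target map `t`. -/
def RightIsogRing (r : ℕ) : Type _ := IsogRing p k r

noncomputable instance (r : ℕ) : CommRing (RightIsogRing p k r) :=
  inferInstanceAs (CommRing (IsogRing p k r))

noncomputable instance (r : ℕ) : Algebra k⟦X⟧ (RightIsogRing p k r) :=
  (IsogRing.target p k r).toAlgebra

/-- The identity map `A_r → A_r`. -/
noncomputable def RightIsogRing.of (r : ℕ) : IsogRing p k r ≃+* RightIsogRing p k r :=
  RingEquiv.refl _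

/-- The ring `A_{r,r'} = A_r ⊗_A A_{r'}`, the tensor product being formed with `t : A → A_r` and
`s : A → A_{r'}`. -/
abbrev IsogRing₂ (r r' : ℕ) : Type _ := RightIsogRing p k r ⊗[k⟦X⟧] IsogRing p k r'

/-- The inclusion `A_r → A_{r,r'}` of the first factor. -/
noncomputable def IsogRing₂.inl (r r' : ℕ) : IsogRing p k r →+* IsogRing₂ p k r r' :=
  (Algebra.TensorProduct.includeLeft :
    RightIsogRing p k r →ₐ[k⟦X⟧] IsogRing₂ p k r r').toRingHom.comp
      (RightIsogRing.of p k r).toRingHom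

/-- The inclusion `A_{r'} → A_{r,r'}` of the second factor. -/
noncomputable def IsogRing₂.inr (r r' : ℕ) : IsogRing p k r' →+* IsogRing₂ p k r r' :=
  (Algebra.TensorProduct.includeRight :
    IsogRing p k r' →ₐ[k⟦X⟧] IsogRing₂ p k r r').toRingHom

theorem IsogRing₂.inl_target (r r' : ℕ) (a : k⟦X⟧) :
    IsogRing₂.inl p k r r' (IsogRing.target p k r a) = IsogRing₂.inr p k r r' (algebraMap _ _ a) :=
  ((Algebra.TensorProduct.includeLeft :
    RightIsogRing p k r →ₐ[k⟦X⟧] IsogRing₂ p k r r').commutes a).trans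
  ((Algebra.TensorProduct.includeRight :
    IsogRing p k r' →ₐ[k⟦X⟧] IsogRing₂ p k r r').commutes a).symm

/-- The ring homomorphism `u₁ : A_{r+r'} → A_{r,r'}` over `s` that sends `x₁` to `1 ⊗ x₁`; in terms
of `A_{r,r'} = k⟦x₀, x₁, x₂⟧ / (F_{p^r}(x₀, x₁), F_{p^{r'}}(x₁, x₂))` it is given by
`x₀ ↦ x₀`, `x₁ ↦ x₂`. -/
noncomputable def IsogRing.u₁ (r r' : ℕ) : IsogRing p k (r + r') →+* IsogRing₂ p k r r' :=
  IsogRing.lift p k (r + r') ((IsogRing₂.inl p k r r').comp (algebraMap k⟦X⟧ (IsogRing p k r)))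
    (IsogRing₂.inr p k r r' (IsogRing.x₁ p k r')) <| by
      refine crossing_comp p
        (((IsogRing₂.inl p k r r').comp (algebraMap k⟦X⟧ (IsogRing p k r))).comp PowerSeries.C)
        r r' _ (IsogRing₂.inl p k r r' (IsogRing.x₁ p k r)) _ ?_ ?_
      · rw [RingHom.comp_apply, ← map_crossing, crossing_x₁, map_zero]
      · rw [← target_X, IsogRing₂.inl_target, ← map_crossing, crossing_x₁, map_zero]

end IsogRing

section Gamma

variable (p : ℕ) (k : Type*) [Field k]

/-- `Γ_r = Hom_A(A_r, A)`, the left `A`-linear dual of `A_r`. -/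
def GammaDeg (r : ℕ) : Type _ := IsogRing p k r →ₗ[k⟦X⟧] k⟦X⟧

noncomputable instance (r : ℕ) : AddCommGroup (GammaDeg p k r) :=
  inferInstanceAs (AddCommGroup (IsogRing p k r →ₗ[k⟦X⟧] k⟦X⟧))

/-- The left action, `(a • φ) m = φ (s(a) m) = a φ(m)`. -/
noncomputable instance (r : ℕ) : Module k⟦X⟧ (GammaDeg p k r) :=
  inferInstanceAs (Module k⟦X⟧ (IsogRing p k r →ₗ[k⟦X⟧] k⟦X⟧))

instance (r : ℕ) : FunLike (GammaDeg p k r) (IsogRing p k r) k⟦X⟧ :=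
  inferInstanceAs (FunLike (IsogRing p k r →ₗ[k⟦X⟧] k⟦X⟧) (IsogRing p k r) k⟦X⟧)

instance (r : ℕ) : LinearMapClass (GammaDeg p k r) k⟦X⟧ (IsogRing p k r) k⟦X⟧ :=
  inferInstanceAs (LinearMapClass (IsogRing p k r →ₗ[k⟦X⟧] k⟦X⟧) k⟦X⟧ (IsogRing p k r) k⟦X⟧)

variable {p k} in
@[ext]
theorem GammaDeg.ext {r : ℕ} {φ ψ : GammaDeg p k r} (h : ∀ m, φ m = ψ m) : φ = ψ :=
  DFunLike.ext _ _ h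

variable {p k} in
@[simp]
theorem GammaDeg.add_apply {r : ℕ} (φ ψ : GammaDeg p k r) (m : IsogRing p k r) :
    (φ + ψ) m = φ m + ψ m := rfl

variable {p k} in
@[simp]
theorem GammaDeg.zero_apply {r : ℕ} (m : IsogRing p k r) : (0 : GammaDeg p k r) m = 0 := rfl

variable {p k} in
@[simp]
theorem GammaDeg.smul_apply {r : ℕ} (a : k⟦X⟧) (φ : GammaDeg p k r) (m : IsogRing p k r) :
    (a • φ) m = a * φ m := rfl

variable [hp : Fact p.Prime] [CharP k p]

/-- The right action, `(φ · b) m = φ (m t(b))`, as a left action of the opposite ring. -/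
noncomputable instance (r : ℕ) : SMul k⟦X⟧ᵐᵒᵖ (GammaDeg p k r) where
  smul b φ := LinearMap.comp (φ : IsogRing p k r →ₗ[k⟦X⟧] k⟦X⟧)
    (LinearMap.mulRight k⟦X⟧ (IsogRing.target p k r b.unop))

variable {p k} in
theorem GammaDeg.op_smul_apply {r : ℕ} (b : k⟦X⟧ᵐᵒᵖ) (φ : GammaDeg p k r) (m : IsogRing p k r) :
    (b • φ) m = φ (m * IsogRing.target p k r b.unop) := rfl

noncomputable instance (r : ℕ) : Module k⟦X⟧ᵐᵒᵖ (GammaDeg p k r) where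
  one_smul φ := by ext m; simp [GammaDeg.op_smul_apply]
  mul_smul a b φ := by
    ext m
    simp only [GammaDeg.op_smul_apply, MulOpposite.unop_mul, map_mul]
    rw [mul_assoc, mul_comm (IsogRing.target p k r b.unop)]
  smul_zero b := by ext m; simp [GammaDeg.op_smul_apply]
  smul_add b φ ψ := by ext m; simp [GammaDeg.op_smul_apply]
  add_smul a b φ := by ext m; simp [GammaDeg.op_smul_apply, mul_add]
  zero_smul φ := by ext m; simp [GammaDeg.op_smul_apply]

instance (r : ℕ) : SMulCommClass k⟦X⟧ k⟦X⟧ᵐᵒᵖ (GammaDeg p k r) where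
  smul_comm a b φ := by ext m; simp [GammaDeg.op_smul_apply]

/-- The map `φ ⊗ ψ : A_r ⊗_A A_{r'} → A`, `(φ ⊗ ψ)(m ⊗ n) = φ (m · ψ(n))`, for `φ ∈ Γ_r` and
`ψ ∈ Γ_{r'}`. -/
noncomputable def GammaDeg.tensor {r r' : ℕ} (φ : GammaDeg p k r) (ψ : GammaDeg p k r') :
    IsogRing₂ p k r r' →+ k⟦X⟧ :=
  TensorProduct.liftAddHom
    (AddMonoidHom.mk' (fun m : RightIsogRing p k r => AddMonoidHom.mk'
        (fun n : IsogRing p k r' =>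
          φ ((RightIsogRing.of p k r).symm m * IsogRing.target p k r (ψ n)))
        (fun n n' => by simp [mul_add]))
      (fun m m' => by
        ext1 n
        simp only [AddMonoidHom.mk'_apply, AddMonoidHom.add_apply, map_add, add_mul]))
    (fun a m n => by
      have h : (RightIsogRing.of p k r).symm (a • m) =
          IsogRing.target p k r a * (RightIsogRing.of p k r).symm m := rfl
      simp only [AddMonoidHom.mk'_apply]
      rw [h, map_smul, smul_eq_mul, map_mul (IsogRing.target p k r), mul_left_comm, mul_assoc])

variable {p k} in
theorem IsogRing₂.inl_mul_inr {r r' : ℕ} (m : IsogRing p k r) (n : IsogRing p k r') :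
    IsogRing₂.inl p k r r' m * IsogRing₂.inr p k r r' n =
      RightIsogRing.of p k r m ⊗ₜ[k⟦X⟧] n := by
  change (RightIsogRing.of p k r m ⊗ₜ[k⟦X⟧] (1 : IsogRing p k r')) *
      ((1 : RightIsogRing p k r) ⊗ₜ[k⟦X⟧] n) = _
  rw [Algebra.TensorProduct.tmul_mul_tmul, one_mul, mul_one]

variable {p k} in
theorem GammaDeg.tensor_mul {r r' : ℕ} (φ : GammaDeg p k r) (ψ : GammaDeg p k r')
    (m : IsogRing p k r) (n : IsogRing p k r') :
    GammaDeg.tensor p k φ ψ (IsogRing₂.inl p k r r' m * IsogRing₂.inr p k r r' n) =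
      φ (m * IsogRing.target p k r (ψ n)) := by
  rw [IsogRing₂.inl_mul_inr]
  rfl

variable {p k} in
theorem IsogRing₂.induction {r r' : ℕ} {P : IsogRing₂ p k r r' → Prop}
    (hmul : ∀ m n, P (IsogRing₂.inl p k r r' m * IsogRing₂.inr p k r r' n))
    (hadd : ∀ u v, P u → P v → P (u + v)) (w : IsogRing₂ p k r r') : P w := by
  have htmul : ∀ (m : RightIsogRing p k r) (n : IsogRing p k r'), P (m ⊗ₜ[k⟦X⟧] n) := by
    intro m n
    have := hmul ((RightIsogRing.of p k r).symm m) n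
    rwa [IsogRing₂.inl_mul_inr, RingEquiv.apply_symm_apply] at this
  induction w using TensorProduct.induction_on with
  | zero => simpa using htmul 0 0
  | tmul m n => exact htmul m n
  | add u v hu hv => exact hadd u v hu hv

variable {p k} in
theorem GammaDeg.tensor_source_mul {r r' : ℕ} (φ : GammaDeg p k r) (ψ : GammaDeg p k r')
    (a : k⟦X⟧) (w : IsogRing₂ p k r r') :
    GammaDeg.tensor p k φ ψ (IsogRing₂.inl p k r r' (algebraMap _ _ a) * w) =
      a * GammaDeg.tensor p k φ ψ w := by
  induction w using IsogRing₂.induction with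
  | hmul m n =>
    rw [← mul_assoc, ← map_mul, GammaDeg.tensor_mul, GammaDeg.tensor_mul, mul_assoc,
      ← Algebra.smul_def, map_smul, smul_eq_mul]
  | hadd u v hu hv => rw [mul_add, map_add, map_add, hu, hv, mul_add]

/-- The product `Γ_r × Γ_{r'} → Γ_{r+r'}`, `(φ ψ)(g) = (φ ⊗ ψ)(u₁(g))`. -/
noncomputable def GammaDeg.mul {r r' : ℕ} (φ : GammaDeg p k r) (ψ : GammaDeg p k r') :
    GammaDeg p k (r + r') :=
  show IsogRing p k (r + r') →ₗ[k⟦X⟧] k⟦X⟧ from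
  { toFun := fun g => GammaDeg.tensor p k φ ψ (IsogRing.u₁ p k r r' g)
    map_add' := fun g g' => by rw [map_add, map_add]
    map_smul' := fun a g => by
      rw [Algebra.smul_def, map_mul, IsogRing.u₁, IsogRing.lift_algebraMap, RingHom.comp_apply,
        GammaDeg.tensor_source_mul]
      rfl }

/-- The unit of `Γ`: the element of `Γ₀ = Hom_A(A_0, A)` given by the isomorphism
`A_0 = k⟦x₀, x₁⟧ / (x₀ - x₁) ≅ A`. -/
noncomputable def GammaDeg.one : GammaDeg p k 0 :=
  show IsogRing p k 0 →ₗ[k⟦X⟧] k⟦X⟧ from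
  { toFun := IsogRing.lift p k 0 (RingHom.id _) PowerSeries.X (by simp [crossing])
    map_add' := map_add _
    map_smul' := fun a m => by
      rw [Algebra.smul_def, map_mul, IsogRing.lift_algebraMap]
      rfl }

variable {p k}

theorem GammaDeg.mul_x₁_pow {r r' : ℕ} (φ : GammaDeg p k r) (ψ : GammaDeg p k r') (j : ℕ) :
    GammaDeg.mul p k φ ψ (IsogRing.x₁ p k (r + r') ^ j) =
      φ (IsogRing.target p k r (ψ (IsogRing.x₁ p k r' ^ j))) := by
  change GammaDeg.tensor p k φ ψ (IsogRing.u₁ p k r r' _) = _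
  rw [map_pow, IsogRing.u₁, IsogRing.lift_x₁, ← map_pow]
  have := GammaDeg.tensor_mul φ ψ 1 (IsogRing.x₁ p k r' ^ j)
  rwa [map_one, one_mul, one_mul] at this

theorem GammaDeg.one_x₁_pow (j : ℕ) :
    GammaDeg.one p k (IsogRing.x₁ p k 0 ^ j) = PowerSeries.X ^ j := by
  change IsogRing.lift p k 0 (RingHom.id _) PowerSeries.X (by simp [crossing]) _ = _
  rw [map_pow, IsogRing.lift_x₁]

theorem GammaDeg.ext_x₁ {r : ℕ} {φ ψ : GammaDeg p k r}
    (h : ∀ j : ℕ, φ (IsogRing.x₁ p k r ^ j) = ψ (IsogRing.x₁ p k r ^ j)) : φ = ψ := by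
  have : (φ : IsogRing p k r →ₗ[k⟦X⟧] k⟦X⟧) = ψ :=
    (IsogRing.basis p k r).ext fun i => by
      rw [IsogRing.basis_apply]
      exact h i
  exact this

/-- Powers of `x₁` are divisible by powers of `x₀`. -/
theorem IsogRing.exists_x₁_pow_eq (r : ℕ) :
    ∃ N, ∀ m, ∃ w, IsogRing.x₁ p k r ^ (N * m) =
      algebraMap k⟦X⟧ (IsogRing p k r) (PowerSeries.X ^ m) * w := by
  suffices h : ∃ N, ∃ w, IsogRing.x₁ p k r ^ N =
      algebraMap k⟦X⟧ (IsogRing p k r) PowerSeries.X * w by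
    obtain ⟨N, w, h⟩ := h
    exact ⟨N, fun m => ⟨w ^ m, by rw [pow_mul, h, mul_pow, map_pow]⟩⟩
  refine ⟨∑ i ∈ Finset.range (r + 1), p ^ (r - i), ?_⟩
  suffices h : algebraMap k⟦X⟧ (IsogRing p k r) PowerSeries.X ∣
      IsogRing.x₁ p k r ^ (∑ i ∈ Finset.range (r + 1), p ^ (r - i)) from h
  have h0 := neg_one_pow_mul_crossing p r
    (algebraMap k⟦X⟧ (IsogRing p k r) PowerSeries.X) (IsogRing.x₁ p k r)
  rw [crossing_x₁, mul_zero] at h0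
  rw [← Finset.prod_pow_eq_pow_sum, ← Ideal.mem_span_singleton, ← Ideal.Quotient.eq_zero_iff_mem]
  have h1 := congrArg (Ideal.Quotient.mk
    (Ideal.span {algebraMap k⟦X⟧ (IsogRing p k r) PowerSeries.X})) h0
  rw [map_zero, map_prod] at h1
  rw [map_prod, ← h1]
  refine Finset.prod_congr rfl fun i _ => ?_
  rw [map_sub, map_pow _ (algebraMap k⟦X⟧ (IsogRing p k r) PowerSeries.X),
    Ideal.Quotient.eq_zero_iff_mem.mpr (Ideal.mem_span_singleton_self _),
    zero_pow (pow_ne_zero _ hp.out.ne_zero), sub_zero]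

theorem GammaDeg.X_pow_dvd {r : ℕ} (φ : GammaDeg p k r) :
    ∃ N, ∀ (m : ℕ) (h : k⟦X⟧),
      (PowerSeries.X : k⟦X⟧) ^ m ∣ φ (IsogRing.target p k r (PowerSeries.X ^ (N * m) * h)) := by
  obtain ⟨N, hN⟩ := IsogRing.exists_x₁_pow_eq (p := p) (k := k) r
  refine ⟨N, fun m h => ?_⟩
  obtain ⟨w, hw⟩ := hN m
  rw [map_mul, map_pow, target_X, hw, mul_assoc, ← Algebra.smul_def, map_smul]
  exact Dvd.intro _ rfl

/-- Two additive maps `A → A` that agree on monomials and are continuous for the `x`-adic topology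
are equal. -/
theorem additive_ext (d : k⟦X⟧ →+ k⟦X⟧)
    (h0 : ∀ (c : k) (j : ℕ), d (PowerSeries.C c * PowerSeries.X ^ j) = 0)
    (h1 : ∀ m : ℕ, ∃ n : ℕ, ∀ g, (PowerSeries.X : k⟦X⟧) ^ m ∣ d (PowerSeries.X ^ n * g)) :
    d = 0 := by
  ext1 f
  rw [AddMonoidHom.zero_apply]
  have hdiv : ∀ m : ℕ, (PowerSeries.X : k⟦X⟧) ^ m ∣ d f := by
    intro m
    obtain ⟨n, hn⟩ := h1 m
    have hf : (PowerSeries.X : k⟦X⟧) ^ n ∣ f - (PowerSeries.trunc n f : Polynomial k) := by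
      rw [PowerSeries.X_pow_dvd_iff]
      intro i hi
      simp [PowerSeries.coeff_trunc, hi]
    obtain ⟨g, hg⟩ := hf
    have ht : d ((PowerSeries.trunc n f : Polynomial k) : k⟦X⟧) = 0 := by
      induction (PowerSeries.trunc n f) using Polynomial.induction_on' with
      | add q q' hq hq' => rw [Polynomial.coe_add, map_add, hq, hq', add_zero]
      | monomial j c =>
        rw [← Polynomial.C_mul_X_pow_eq_monomial, Polynomial.coe_mul, Polynomial.coe_pow,
          Polynomial.coe_C, Polynomial.coe_X, h0]
    have : d f = d (PowerSeries.X ^ n * g) := by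
      rw [← hg, map_sub, ht, sub_zero]
    rw [this]
    exact hn g
  ext i
  exact (PowerSeries.X_pow_dvd_iff.mp (hdiv (i + 1))) i (Nat.lt_succ_self i)

theorem GammaDeg.target_monomial {r : ℕ} (φ : GammaDeg p k r) (c : k) (h : k⟦X⟧) :
    φ (IsogRing.target p k r (PowerSeries.C c * h)) =
      PowerSeries.C (c ^ p ^ r) * φ (IsogRing.target p k r h) := by
  rw [map_mul, target_C, ← Algebra.smul_def, map_smul, smul_eq_mul]

theorem GammaDeg.mul_target {r r' : ℕ} (φ : GammaDeg p k r) (ψ : GammaDeg p k r') (f : k⟦X⟧) :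
    GammaDeg.mul p k φ ψ (IsogRing.target p k (r + r') f) =
      φ (IsogRing.target p k r (ψ (IsogRing.target p k r' f))) := by
  let d : k⟦X⟧ →+ k⟦X⟧ := AddMonoidHom.mk'
    (fun f => GammaDeg.mul p k φ ψ (IsogRing.target p k (r + r') f) -
      φ (IsogRing.target p k r (ψ (IsogRing.target p k r' f))))
    (fun f g => by simp only [map_add]; ring)
  have hd : d = 0 := by
    refine additive_ext d (fun c j => ?_) (fun m => ?_)
    · change GammaDeg.mul p k φ ψ _ - φ _ = 0
      rw [GammaDeg.target_monomial, GammaDeg.target_monomial, GammaDeg.target_monomial,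
        map_pow (IsogRing.target p k (r + r')), map_pow (IsogRing.target p k r'), target_X, target_X,
        GammaDeg.mul_x₁_pow, ← pow_mul, ← pow_add,
        add_comm r' r, sub_self]
    · obtain ⟨N, hN⟩ := GammaDeg.X_pow_dvd (GammaDeg.mul p k φ ψ)
      obtain ⟨N₁, hN₁⟩ := GammaDeg.X_pow_dvd φ
      obtain ⟨N₂, hN₂⟩ := GammaDeg.X_pow_dvd ψ
      refine ⟨N * m + N₂ * (N₁ * m), fun g => dvd_sub ?_ ?_⟩
      · rw [pow_add, mul_assoc]
        exact hN _ _
      · rw [pow_add, mul_comm (PowerSeries.X ^ (N * m)), mul_assoc]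
        obtain ⟨v, hv⟩ := hN₂ (N₁ * m) (PowerSeries.X ^ (N * m) * g)
        rw [hv]
        exact hN₁ _ _
  exact sub_eq_zero.mp (DFunLike.congr_fun hd f)

theorem GammaDeg.one_target (f : k⟦X⟧) : GammaDeg.one p k (IsogRing.target p k 0 f) = f := by
  let d : k⟦X⟧ →+ k⟦X⟧ := AddMonoidHom.mk'
    (fun f => GammaDeg.one p k (IsogRing.target p k 0 f) - f)
    (fun f g => by simp only [map_add]; ring)
  have hd : d = 0 := by
    refine additive_ext d (fun c j => ?_) (fun m => ?_)
    · change GammaDeg.one p k _ - _ = 0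
      rw [GammaDeg.target_monomial, map_pow (IsogRing.target p k 0), target_X, GammaDeg.one_x₁_pow]
      simp
    · obtain ⟨N, hN⟩ := GammaDeg.X_pow_dvd (GammaDeg.one p k)
      refine ⟨N * m + m, fun g => dvd_sub ?_ ?_⟩
      · rw [pow_add, mul_assoc]
        exact hN _ _
      · rw [pow_add, mul_assoc, mul_left_comm]
        exact Dvd.intro _ rfl
  exact sub_eq_zero.mp (DFunLike.congr_fun hd f)

theorem GammaDeg.sigma_ext {r r' : ℕ} (e : r = r') {φ : GammaDeg p k r} {ψ : GammaDeg p k r'}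
    (h : ∀ j : ℕ, φ (IsogRing.x₁ p k r ^ j) = ψ (IsogRing.x₁ p k r' ^ j)) :
    (⟨r, φ⟩ : GradedMonoid (GammaDeg p k)) = ⟨r', ψ⟩ := by
  subst e
  rw [GammaDeg.ext_x₁ h]

theorem GammaDeg.mul_apply {r r' : ℕ} (φ : GammaDeg p k r) (ψ : GammaDeg p k r')
    (g : IsogRing p k (r + r')) :
    GammaDeg.mul p k φ ψ g = GammaDeg.tensor p k φ ψ (IsogRing.u₁ p k r r' g) := rfl

variable (p k)

noncomputable instance : GradedMonoid.GMul (GammaDeg p k) where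
  mul φ ψ := GammaDeg.mul p k φ ψ

noncomputable instance : GradedMonoid.GOne (GammaDeg p k) where
  one := GammaDeg.one p k

noncomputable instance : GradedMonoid.GMonoid (GammaDeg p k) where
  one_mul := fun ⟨r, φ⟩ => GammaDeg.sigma_ext (zero_add r) fun j => by
    change GammaDeg.mul p k (GammaDeg.one p k) φ _ = _
    rw [GammaDeg.mul_x₁_pow, GammaDeg.one_target]
  mul_one := fun ⟨r, φ⟩ => GammaDeg.sigma_ext (add_zero r) fun j => by
    change GammaDeg.mul p k φ (GammaDeg.one p k) _ = _
    rw [GammaDeg.mul_x₁_pow, GammaDeg.one_x₁_pow, map_pow, target_X]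
  mul_assoc := fun ⟨r, φ⟩ ⟨r', ψ⟩ ⟨r'', χ⟩ => GammaDeg.sigma_ext (add_assoc r r' r'') fun j => by
    change GammaDeg.mul p k (GammaDeg.mul p k φ ψ) χ _ =
      GammaDeg.mul p k φ (GammaDeg.mul p k ψ χ) _
    rw [GammaDeg.mul_x₁_pow, GammaDeg.mul_x₁_pow, GammaDeg.mul_x₁_pow, GammaDeg.mul_target]

noncomputable instance : DirectSum.GRing (GammaDeg p k) where
  mul_zero φ := GammaDeg.ext_x₁ fun j => by
    change GammaDeg.mul p k _ _ _ = _
    rw [GammaDeg.mul_x₁_pow]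
    simp
  zero_mul ψ := GammaDeg.ext_x₁ fun j => by
    change GammaDeg.mul p k _ _ _ = _
    rw [GammaDeg.mul_x₁_pow]
    simp
  mul_add φ ψ ψ' := GammaDeg.ext_x₁ fun j => by
    change GammaDeg.mul p k _ _ _ = GammaDeg.mul p k _ _ _ + GammaDeg.mul p k _ _ _
    rw [GammaDeg.mul_x₁_pow, GammaDeg.mul_x₁_pow, GammaDeg.mul_x₁_pow]
    simp
  add_mul φ φ' ψ := GammaDeg.ext_x₁ fun j => by
    change GammaDeg.mul p k _ _ _ = GammaDeg.mul p k _ _ _ + GammaDeg.mul p k _ _ _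
    rw [GammaDeg.mul_x₁_pow, GammaDeg.mul_x₁_pow, GammaDeg.mul_x₁_pow]
    simp
  natCast n := n • GammaDeg.one p k
  natCast_zero := zero_smul _ _
  natCast_succ n := by
    change (n + 1) • GammaDeg.one p k = n • GammaDeg.one p k + GammaDeg.one p k
    rw [add_smul, one_smul]
  intCast n := n • GammaDeg.one p k
  intCast_ofNat n := natCast_zsmul _ _
  intCast_negSucc_ofNat n := by
    rw [negSucc_zsmul]

/-- The graded ring `Γ = ⨁ Γ_r`. -/
abbrev Gamma : Type _ := ⨁ r, GammaDeg p k r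


end Gamma

section TensorRing

variable (R : Type*) [CommRing R] (M : Type*) [AddCommGroup M] [Module R M] [Module Rᵐᵒᵖ M]
  [SMulCommClass R Rᵐᵒᵖ M]

/-- The relations that define the tensor algebra of an `R`-bimodule `M` (the right action is
written as an action of `Rᵐᵒᵖ`) as a quotient of the free ring on `R ⊕ M`: the map from `R` is a
ring homomorphism, and the map from `M` is additive and compatible with both actions. -/
inductive TensorRing.Rel : FreeAlgebra ℤ (R ⊕ M) → FreeAlgebra ℤ (R ⊕ M) → Prop
  | base_one : Rel (FreeAlgebra.ι ℤ (Sum.inl 1)) 1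
  | base_add (a b : R) : Rel (FreeAlgebra.ι ℤ (Sum.inl (a + b)))
      (FreeAlgebra.ι ℤ (Sum.inl a) + FreeAlgebra.ι ℤ (Sum.inl b))
  | base_mul (a b : R) : Rel (FreeAlgebra.ι ℤ (Sum.inl (a * b)))
      (FreeAlgebra.ι ℤ (Sum.inl a) * FreeAlgebra.ι ℤ (Sum.inl b))
  | add (m n : M) : Rel (FreeAlgebra.ι ℤ (Sum.inr (m + n)))
      (FreeAlgebra.ι ℤ (Sum.inr m) + FreeAlgebra.ι ℤ (Sum.inr n))
  | left_smul (a : R) (m : M) : Rel (FreeAlgebra.ι ℤ (Sum.inr (a • m)))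
      (FreeAlgebra.ι ℤ (Sum.inl a) * FreeAlgebra.ι ℤ (Sum.inr m))
  | right_smul (m : M) (a : R) : Rel (FreeAlgebra.ι ℤ (Sum.inr (MulOpposite.op a • m)))
      (FreeAlgebra.ι ℤ (Sum.inr m) * FreeAlgebra.ι ℤ (Sum.inl a))

/-- The tensor algebra `T_R(M) = ⨁ M ⊗_R ⋯ ⊗_R M` of an `R`-bimodule `M`, that is, the universal
ring under `R` with an `R`-bimodule homomorphism from `M`. -/
def TensorRing : Type _ := RingQuot (TensorRing.Rel R M)

noncomputable instance : Ring (TensorRing R M) :=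
  inferInstanceAs (Ring (RingQuot (TensorRing.Rel R M)))

variable {R}

/-- The structure map `R → T_R(M)`. -/
noncomputable def TensorRing.ofBase (a : R) : TensorRing R M :=
  RingQuot.mkRingHom (TensorRing.Rel R M) (FreeAlgebra.ι ℤ (Sum.inl a))

variable {M} (R)

/-- The structure map `M → T_R(M)`. -/
noncomputable def TensorRing.ofModule (m : M) : TensorRing R M :=
  RingQuot.mkRingHom (TensorRing.Rel R M) (FreeAlgebra.ι ℤ (Sum.inr m))

variable (M)

/-- The degree `r` part of `T_R(M)`, the image of `M ⊗_R ⋯ ⊗_R M` (with `r` factors); it is the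
image of `R` for `r = 0`. -/
noncomputable def TensorRing.degreePart (r : ℕ) : AddSubgroup (TensorRing R M) :=
  AddSubgroup.closure {t | ∃ (a : R) (m : Fin r → M),
    t = TensorRing.ofBase M a * (List.ofFn fun i => TensorRing.ofModule R (m i)).prod}

end TensorRing

section Delta

variable (p : ℕ) [hp : Fact p.Prime] (k : Type*) [Field k] [CharP k p]

/-- The elements `P_0, …, P_p` of `Γ_1`, the left `A`-basis dual to the basis `1, x₁, …, x₁ ^ p` of
`A_1`. -/
noncomputable def GammaDeg.P (i : Fin (p + 1)) : GammaDeg p k 1 :=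
  (IsogRing.basis p k 1).coord
    (Fin.cast (by rw [Finset.sum_range_succ, Finset.sum_range_one, pow_zero, pow_one, add_comm]) i)

/-- The element `∑_j x ^ j P_i P_j` of the tensor algebra of the `A`-bimodule `Γ_1`. -/
noncomputable def relator (i : Fin (p + 1)) : TensorRing k⟦X⟧ (GammaDeg p k 1) :=
  ∑ j : Fin (p + 1), TensorRing.ofBase _ (PowerSeries.X ^ (j : ℕ)) *
    TensorRing.ofModule k⟦X⟧ (GammaDeg.P p k i) * TensorRing.ofModule k⟦X⟧ (GammaDeg.P p k j)

/-- The two-sided ideal generated by the elements `∑_j x ^ j P_i P_j` for `i = 1, …, p`. -/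
noncomputable def relationIdeal : TwoSidedIdeal (TensorRing k⟦X⟧ (GammaDeg p k 1)) :=
  TwoSidedIdeal.span {t | ∃ i : Fin (p + 1), i ≠ 0 ∧ t = relator p k i}

/-- The quotient `Δ` of the tensor algebra of the `A`-bimodule `Γ_1` by the relations
`∑_j x ^ j P_i P_j = 0` for `i = 1, …, p`. -/
abbrev Delta : Type _ := (relationIdeal p k).ringCon.Quotient

/-- The quotient map from the tensor algebra of `Γ_1` to `Δ`. -/
noncomputable def Delta.mk : TensorRing k⟦X⟧ (GammaDeg p k 1) →+* Delta p k := (relationIdeal p k).ringCon.mk'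

variable {p}

/-- A sequence of elements of `{0, …, p}` is admissible if no nonzero entry is directly followed by
a zero, so that all zeros are at the beginning. -/
def Admissible {r : ℕ} (I : Fin r → Fin (p + 1)) : Prop :=
  ∀ i j : Fin r, (j : ℕ) = i + 1 → I i ≠ 0 → I j ≠ 0

/-- The monomial `P_I = P_{i_1} ⋯ P_{i_r}` in `Γ`. -/
noncomputable def Gamma.monomial {r : ℕ} (I : Fin r → Fin (p + 1)) : Gamma p k :=
  (List.ofFn fun j => DirectSum.of (GammaDeg p k) 1 (GammaDeg.P p k (I j))).prod

end Delta

end Isogeny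

open Isogeny

namespace Isogeny

/-! ### Dual bases of `A_r` and `Γ_r` -/

section Dual

variable {p : ℕ} [hp : Fact p.Prime] {k : Type*} [Field k]

/-! The proof is a rank count. Put `N_r = 1 + p + ⋯ + p ^ r`. Then `Γ_r` is free of rank `N_r` over
`A`, being dual to `A_r`, and `N_r` is also the number of admissible sequences of length `r`
(`card_admissible`). So it is enough that `Δ → Γ` exists, that it is onto in each degree, and that
the admissible words span `Δ_r`. A spanning family of `N_r` elements in a free module of rank `N_r`
is a basis, and independence in `Γ_r` leaves no room for a kernel in `Δ_r`.

The map exists because the relations hold in `Γ` (`GammaDeg.sum_X_pow_smul_mul`). The polynomial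
`F_p(x, y) = (x - y^p)(x^p - y)` is symmetric, so `A_1` has an endomorphism that takes `s` to `t`
and `x₁` to `x₀`. Applied to the expansion of `x₁^n` in the basis `1, …, x₁^p` it expresses `x₀^n`
through `t(P_j(x₁^n)) x₀^j`, and `P_i` with `i ≠ 0` kills `x₀^n`.

Admissible words span `Δ_r` (`wordSpan_le_admissibleSpan`) because the relations rewrite `P_i P_0`,
for `i ≠ 0`, by the products `P_i P_j` with `j ≠ 0`, and elements of `A` can be moved to the left
past the `P_i`.

Surjectivity is the substantial point: `Γ_r ⊗ Γ_1 → Γ_{r+1}` is onto (`GammaDeg.span_mul`). Modulo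
`x₀` the ring `A_{r+1}` becomes `k[x₁]/(x₁^{N_{r+1}})`, and a functional that does not vanish on the
top power of `x₁` generates the dual under multiplication by powers of `x₁`. By Nakayama one product
`φψ` whose value on this power is a unit suffices. Such a product exists unless `x₀^{N_r}` divides
`x₁^{p N_r}` in `A_1`, which is excluded by comparing the two components of `Spec A_1`
(`IsogRing.not_X_pow_dvd_x₁_pow`). -/

theorem GammaDeg.sum_apply {ι : Type*} (s : Finset ι) {r : ℕ} (φ : ι → GammaDeg p k r)
    (m : IsogRing p k r) : (∑ i ∈ s, φ i) m = ∑ i ∈ s, φ i m :=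
  LinearMap.sum_apply s φ m

theorem IsogRing.ringHom_ext {B : Type*} [CommRing B] {r : ℕ} {f g : IsogRing p k r →+* B}
    (hs : ∀ a, f (algebraMap k⟦X⟧ _ a) = g (algebraMap k⟦X⟧ _ a))
    (hx : f (IsogRing.x₁ p k r) = g (IsogRing.x₁ p k r)) : f = g := by
  ext w
  rw [← (IsogRing.basis p k r).sum_repr w, map_sum, map_sum]
  refine Finset.sum_congr rfl fun i _ => ?_
  rw [IsogRing.basis_apply, Algebra.smul_def, map_mul, map_mul, map_pow, map_pow, hs, hx]

variable (p k) in
/-- The left `A`-basis of `Γ_r` dual to the basis `1, x₁, x₁ ^ 2, …` of `A_r`. -/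
noncomputable def GammaDeg.basis (r : ℕ) :
    Module.Basis (Fin (∑ i ∈ Finset.range (r + 1), p ^ i)) k⟦X⟧ (GammaDeg p k r) :=
  (IsogRing.basis p k r).dualBasis

theorem GammaDeg.basis_repr {r : ℕ} (φ : GammaDeg p k r)
    (i : Fin (∑ i ∈ Finset.range (r + 1), p ^ i)) :
    (GammaDeg.basis p k r).repr φ i = φ (IsogRing.x₁ p k r ^ (i : ℕ)) := by
  rw [← IsogRing.basis_apply]
  exact (IsogRing.basis p k r).dualBasis_repr φ i

theorem GammaDeg.basis_apply {r : ℕ} (i : Fin (∑ i ∈ Finset.range (r + 1), p ^ i))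
    (m : IsogRing p k r) : GammaDeg.basis p k r i m = (IsogRing.basis p k r).repr m i := by
  change (IsogRing.basis p k r).dualBasis i m = _
  rw [Module.Basis.coe_dualBasis, Module.Basis.coord_apply]

theorem GammaDeg.basis_x₁_pow {r : ℕ} (i j : Fin (∑ i ∈ Finset.range (r + 1), p ^ i)) :
    GammaDeg.basis p k r i (IsogRing.x₁ p k r ^ (j : ℕ)) = if j = i then 1 else 0 := by
  rw [GammaDeg.basis_apply, ← IsogRing.basis_apply, Module.Basis.repr_self, Finsupp.single_apply]

theorem GammaDeg.sum_basis {r : ℕ} (φ : GammaDeg p k r) :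
    ∑ i : Fin (∑ i ∈ Finset.range (r + 1), p ^ i),
      φ (IsogRing.x₁ p k r ^ (i : ℕ)) • GammaDeg.basis p k r i = φ := by
  simp only [← GammaDeg.basis_repr]
  exact (GammaDeg.basis p k r).sum_repr φ

instance (r : ℕ) : Module.Free k⟦X⟧ (GammaDeg p k r) := .of_basis (GammaDeg.basis p k r)

instance (r : ℕ) : Module.Finite k⟦X⟧ (GammaDeg p k r) := .of_basis (GammaDeg.basis p k r)

theorem GammaDeg.finrank (r : ℕ) :
    Module.finrank k⟦X⟧ (GammaDeg p k r) = ∑ i ∈ Finset.range (r + 1), p ^ i := by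
  rw [Module.finrank_eq_card_basis (GammaDeg.basis p k r), Fintype.card_fin]

theorem IsogRing.sum_basis {r : ℕ} (w : IsogRing p k r) :
    w = ∑ i, algebraMap k⟦X⟧ _ (GammaDeg.basis p k r i w) * IsogRing.x₁ p k r ^ (i : ℕ) := by
  conv_lhs => rw [← (IsogRing.basis p k r).sum_repr w]
  simp only [GammaDeg.basis_apply, IsogRing.basis_apply, Algebra.smul_def]

/-- `x₁ ^ (1 + p + ⋯ + p ^ r)` is divisible by `x₀`. -/
theorem IsogRing.X_dvd_x₁_pow (r : ℕ) : algebraMap k⟦X⟧ (IsogRing p k r) PowerSeries.X ∣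
    IsogRing.x₁ p k r ^ (∑ i ∈ Finset.range (r + 1), p ^ i) := by
  have h0 := neg_one_pow_mul_crossing p r
    (algebraMap k⟦X⟧ (IsogRing p k r) PowerSeries.X) (IsogRing.x₁ p k r)
  rw [crossing_x₁, mul_zero] at h0
  have h2 : ∑ i ∈ Finset.range (r + 1), p ^ i = ∑ i ∈ Finset.range (r + 1), p ^ (r - i) := by
    rw [← Finset.sum_range_reflect]
    simp only [Nat.add_sub_cancel]
  rw [h2, ← Finset.prod_pow_eq_pow_sum, ← Ideal.mem_span_singleton,
    ← Ideal.Quotient.eq_zero_iff_mem]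
  -- Modulo `x₀` each factor `x₁^{p^(r-i)} - x₀^{p^i}` of the vanishing product reduces to its first
  -- term.
  have h1 := congrArg (Ideal.Quotient.mk
    (Ideal.span {algebraMap k⟦X⟧ (IsogRing p k r) PowerSeries.X})) h0
  rw [map_zero, map_prod] at h1
  rw [map_prod, ← h1]
  refine Finset.prod_congr rfl fun i _ => ?_
  rw [map_sub, map_pow _ (algebraMap k⟦X⟧ (IsogRing p k r) PowerSeries.X),
    Ideal.Quotient.eq_zero_iff_mem.mpr (Ideal.mem_span_singleton_self _),
    zero_pow (pow_ne_zero _ hp.out.ne_zero), sub_zero]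

/-- Left linearity turns divisibility by `x₀` in `A_r` into divisibility of the value by `x`. This
lets functionals be computed modulo `x` as on `k[x₁]/(x₁^N)`, where `N` is the rank of `A_r`. -/
theorem GammaDeg.constantCoeff_eq_zero {r : ℕ} (φ : GammaDeg p k r) {m : IsogRing p k r}
    (h : IsogRing.x₁ p k r ^ (∑ i ∈ Finset.range (r + 1), p ^ i) ∣ m) :
    PowerSeries.constantCoeff (φ m) = 0 := by
  obtain ⟨w, rfl⟩ := (IsogRing.X_dvd_x₁_pow r).trans h
  rw [← Algebra.smul_def, map_smul, smul_eq_mul, map_mul, PowerSeries.constantCoeff_X, zero_mul]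

/-! ### Reduction modulo `x₀` and surjectivity of the multiplication -/

variable [CharP k p]

/-- Modulo `x₀`, the target map sends `∑ c_i x ^ i` to `∑ c_i ^ p ^ r x₁ ^ i`. -/
theorem GammaDeg.constantCoeff_basis_target {r : ℕ}
    (i : Fin (∑ i ∈ Finset.range (r + 1), p ^ i)) (g : k⟦X⟧) :
    PowerSeries.constantCoeff (GammaDeg.basis p k r i (IsogRing.target p k r g)) =
      PowerSeries.coeff (i : ℕ) g ^ p ^ r := by
  let N := ∑ i ∈ Finset.range (r + 1), p ^ i
  -- Truncation at order `N` loses nothing modulo `x₀`, because `t` sends the remainder to a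
  -- multiple of `x₁^N`. The remaining monomials are read off by duality.
  have hf : (PowerSeries.X : k⟦X⟧) ^ N ∣
      g - ∑ m ∈ Finset.range N, PowerSeries.C (PowerSeries.coeff m g) * PowerSeries.X ^ m := by
    rw [PowerSeries.X_pow_dvd_iff]
    intro n hn
    simp [PowerSeries.coeff_X_pow, hn]
  obtain ⟨h, hh⟩ := hf
  have hg := sub_eq_iff_eq_add'.mp hh
  conv_lhs => rw [hg]
  have hz : PowerSeries.constantCoeff (GammaDeg.basis p k r i
      (IsogRing.target p k r (PowerSeries.X ^ N * h))) = 0 :=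
    GammaDeg.constantCoeff_eq_zero _ (by rw [map_mul, map_pow, target_X]; exact Dvd.intro _ rfl)
  rw [map_add, map_add, map_add, hz, add_zero, map_sum, map_sum, map_sum,
    Finset.sum_eq_single (i : ℕ)]
  · rw [GammaDeg.target_monomial, map_pow (IsogRing.target p k r), target_X,
      GammaDeg.basis_x₁_pow, if_pos rfl, mul_one, PowerSeries.constantCoeff_C]
  · intro m hm hmi
    rw [GammaDeg.target_monomial, map_pow (IsogRing.target p k r), target_X,
      GammaDeg.basis_x₁_pow i ⟨m, Finset.mem_range.mp hm⟩, if_neg (by simpa [Fin.ext_iff] using hmi),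
      mul_zero, map_zero]
  · intro hi
    exact absurd (Finset.mem_range.mpr i.2) hi

/-- In `A_1`, the power `x₁ ^ (p * N)` is not divisible by `x₀ ^ N`, because the two components
`x₁ = x₀ ^ p` and `x₀ = x₁ ^ p` of `Spec A_1` meet in the closed point. -/
theorem IsogRing.not_X_pow_dvd_x₁_pow {N : ℕ} (hN : 0 < N) :
    ¬ algebraMap k⟦X⟧ (IsogRing p k 1) (PowerSeries.X ^ N) ∣ IsogRing.x₁ p k 1 ^ (p * N) := by
  rintro ⟨w, hw⟩
  have hchar : CharP k⟦X⟧ p := charP_of_injective_algebraMap (R := k) (RingHom.injective _) p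
  -- `e₁` and `e₂` restrict to the components `x₁ = x₀^p` and `x₀ = x₁^p`. On the second one the
  -- coefficients are raised to the power `p` as well, so the values at the closed point agree only
  -- up to Frobenius.
  let e₁ : IsogRing p k 1 →+* k⟦X⟧ := IsogRing.lift p k 1 (RingHom.id _) (PowerSeries.X ^ p)
    (by simp [crossing, Finset.prod_range_succ])
  let e₂ : IsogRing p k 1 →+* k⟦X⟧ := IsogRing.lift p k 1 (frobenius k⟦X⟧ p) PowerSeries.X
    (by simp [crossing, Finset.prod_range_succ, frobenius_def])
  have he : (PowerSeries.constantCoeff (R := k)).comp e₂ =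
      (frobenius k p).comp ((PowerSeries.constantCoeff (R := k)).comp e₁) := by
    refine IsogRing.ringHom_ext (fun a => ?_) ?_
    · simp [e₁, e₂, IsogRing.lift_algebraMap, frobenius_def]
    · simp [e₁, e₂, IsogRing.lift_x₁, frobenius_def, hp.out.ne_zero]
  have hX : ∀ n, (PowerSeries.X : k⟦X⟧) ^ n ≠ 0 := fun n => pow_ne_zero _ PowerSeries.X_ne_zero
  have h1 := congrArg e₁ hw
  have h2 := congrArg e₂ hw
  simp only [map_mul, map_pow, e₁, e₂, IsogRing.lift_x₁, IsogRing.lift_algebraMap,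
    RingHom.id_apply, frobenius_def] at h1 h2
  change _ = _ * e₁ w at h1
  change _ = _ * e₂ w at h2
  -- On the second component `x₁^{pN}` equals `x₀^N`, so the quotient `w` is `1`. On the first it is
  -- `x^{p²N - N}`, of positive order, hence zero at the closed point.
  have h2' : e₂ w = 1 := by
    rw [← pow_mul] at h2
    exact (mul_left_cancel₀ (hX _) ((mul_one _).trans h2)).symm
  obtain ⟨q, hq⟩ : ∃ q, p * (p * N) = N + (q + 1) := by
    have h := hp.out.two_le
    refine ⟨p * (p * N) - N - 1, ?_⟩
    have : 2 * (2 * N) ≤ p * (p * N) := Nat.mul_le_mul h (Nat.mul_le_mul_right _ h)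
    omega
  have h1' : e₁ w = PowerSeries.X ^ (q + 1) := by
    rw [← pow_mul, hq, pow_add] at h1
    exact (mul_left_cancel₀ (hX _) h1).symm
  have := RingHom.congr_fun he w
  simp [h1', h2', frobenius_def, hp.out.ne_zero] at this

/-- If every functional took a value divisible by `x^N`, so would the coordinates of `x₁^{pN}`, and
`x₀^N` would divide it. -/
theorem GammaDeg.exists_not_X_pow_dvd {N : ℕ} (hN : 0 < N) :
    ∃ ψ : GammaDeg p k 1, ¬ PowerSeries.X ^ N ∣ ψ (IsogRing.x₁ p k 1 ^ (p * N)) := by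
  by_contra! h
  refine IsogRing.not_X_pow_dvd_x₁_pow (p := p) (k := k) hN ?_
  rw [IsogRing.sum_basis (IsogRing.x₁ p k 1 ^ (p * N))]
  exact Finset.dvd_sum fun i _ => Dvd.dvd.mul_right (map_dvd _ (h _)) _

/-- The right action on a product can be absorbed by the second factor, so right multiples of a
product are again products. -/
theorem GammaDeg.op_smul_mul {r r' : ℕ} (b : k⟦X⟧ᵐᵒᵖ) (φ : GammaDeg p k r)
    (ψ : GammaDeg p k r') :
    b • GammaDeg.mul p k φ ψ = GammaDeg.mul p k φ (b • ψ) := by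
  refine GammaDeg.ext_x₁ fun j => ?_
  rw [GammaDeg.op_smul_apply, GammaDeg.mul_x₁_pow, GammaDeg.op_smul_apply, ← target_X, ← target_X,
    ← map_pow, ← map_mul, GammaDeg.mul_target, ← map_pow, ← map_mul]

/-- The multiplication `Γ_r ⊗ Γ_1 → Γ_{r+1}` is surjective. -/
theorem GammaDeg.span_mul (r : ℕ) :
    Submodule.span k⟦X⟧ {θ : GammaDeg p k (r + 1) | ∃ (φ : GammaDeg p k r) (ψ : GammaDeg p k 1),
      θ = GammaDeg.mul p k φ ψ} = ⊤ := by
  set S := Submodule.span k⟦X⟧ {θ : GammaDeg p k (r + 1) |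
    ∃ (φ : GammaDeg p k r) (ψ : GammaDeg p k 1), θ = GammaDeg.mul p k φ ψ}
  set N := ∑ i ∈ Finset.range (r + 1), p ^ i with hNdef
  have hNpos : 0 < N := Finset.sum_pos (fun i _ => pow_pos hp.out.pos _) ⟨0, by simp⟩
  -- Thus `x₁^{pN}` is the last element of the basis of `A_{r+1}`, and every higher power of `x₁` is
  -- divisible by `x₀`.
  have hN1 : ∑ i ∈ Finset.range (r + 1 + 1), p ^ i = p * N + 1 := by
    rw [Finset.sum_range_succ', hNdef, Finset.mul_sum]
    simp [pow_succ']
  obtain ⟨ψ, hψ⟩ := GammaDeg.exists_not_X_pow_dvd (p := p) (k := k) hNpos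
  rw [PowerSeries.X_pow_dvd_iff] at hψ
  push Not at hψ
  obtain ⟨i, hi, hne⟩ := hψ
  -- The index `i < N` is one where `ψ(x₁^{pN})` has a nonzero coefficient. Modulo `x`, the dual
  -- basis element `φ` reads off this coefficient after `t`, raised to the power `p^r`.
  let φ : GammaDeg p k r := GammaDeg.basis p k r ⟨i, hi⟩
  have hc : PowerSeries.constantCoeff (GammaDeg.mul p k φ ψ (IsogRing.x₁ p k (r + 1) ^ (p * N)))
      ≠ 0 := by
    rw [GammaDeg.mul_x₁_pow, GammaDeg.constantCoeff_basis_target]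
    exact pow_ne_zero _ hne
  -- The shift moves the unit value of `φψ` from `x₁^{pN}` to `x₁^m`. Modulo `x` the functional `θ
  -- m` vanishes on `x₁^n` for `n > m`, so the family is triangular with respect to the dual basis.
  let θ : ℕ → GammaDeg p k (r + 1) := fun m =>
    GammaDeg.mul p k φ (MulOpposite.op ((PowerSeries.X : k⟦X⟧) ^ (p * N - m)) • ψ)
  have hθ : ∀ m n, θ m (IsogRing.x₁ p k (r + 1) ^ n) =
      GammaDeg.mul p k φ ψ (IsogRing.x₁ p k (r + 1) ^ (n + (p * N - m))) := by
    intro m n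
    simp only [θ, ← GammaDeg.op_smul_mul]
    rw [GammaDeg.op_smul_apply, MulOpposite.unop_op, map_pow, target_X, pow_add]
  set J := IsLocalRing.maximalIdeal k⟦X⟧
  have hJ : ∀ a : k⟦X⟧, PowerSeries.constantCoeff a = 0 → a ∈ J := by
    intro a ha
    rw [IsLocalRing.mem_maximalIdeal, mem_nonunits_iff, PowerSeries.isUnit_iff_constantCoeff, ha]
    exact not_isUnit_zero
  have key : ∀ (m : ℕ) (hm : m < ∑ i ∈ Finset.range (r + 1 + 1), p ^ i),
      GammaDeg.basis p k (r + 1) ⟨m, hm⟩ ∈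
        S ⊔ J • (⊤ : Submodule k⟦X⟧ (GammaDeg p k (r + 1))) := by
    intro m
    induction m using Nat.strong_induction_on with
    | _ m ih =>
      intro hm
      have hu : IsUnit (θ m (IsogRing.x₁ p k (r + 1) ^ m)) := by
        rw [hθ, PowerSeries.isUnit_iff_constantCoeff, show m + (p * N - m) = p * N by omega]
        exact isUnit_iff_ne_zero.mpr hc
      have hsum := GammaDeg.sum_basis (θ m)
      rw [← Finset.add_sum_erase _ _ (Finset.mem_univ (⟨m, hm⟩ : Fin _))] at hsum
      have hmem : θ m (IsogRing.x₁ p k (r + 1) ^ m) • GammaDeg.basis p k (r + 1) ⟨m, hm⟩ ∈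
          S ⊔ J • (⊤ : Submodule k⟦X⟧ (GammaDeg p k (r + 1))) := by
        rw [← eq_sub_iff_add_eq] at hsum
        rw [hsum]
        refine Submodule.sub_mem _ (Submodule.mem_sup_left (Submodule.subset_span ⟨_, _, rfl⟩))
          (Submodule.sum_mem _ fun n hn => ?_)
        -- Lower terms are handled by induction. For `n > m` the exponent is at least `pN + 1`, so
        -- the coefficient lies in the maximal ideal.
        rcases lt_or_ge (n : ℕ) m with hnm | hnm
        · exact Submodule.smul_mem _ _ (ih n hnm n.2)
        · refine Submodule.mem_sup_right (Submodule.smul_mem_smul (hJ _ ?_) trivial)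
          rw [hθ]
          refine GammaDeg.constantCoeff_eq_zero _ (pow_dvd_pow _ ?_)
          have : (n : ℕ) ≠ m := fun h => (Finset.mem_erase.mp hn).1 (Fin.ext h)
          omega
      exact (Submodule.smul_mem_iff_of_isUnit _ hu).mp hmem
  rw [eq_top_iff]
  -- Nakayama's lemma for the finite module `Γ_{r+1}` over the local ring `A`.
  refine Submodule.le_of_le_smul_of_le_jacobson_bot (I := J) Module.Finite.fg_top
    (IsLocalRing.maximalIdeal_le_jacobson _) ?_
  rw [← (GammaDeg.basis p k (r + 1)).span_eq, Submodule.span_le]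
  rintro _ ⟨n, rfl⟩
  have := key n n.2
  rwa [← (GammaDeg.basis p k (r + 1)).span_eq] at this

/-! ### The generators `P_i` and their quadratic relations -/

theorem GammaDeg.P_eq (i : Fin (p + 1)) (h : (i : ℕ) < ∑ i ∈ Finset.range (1 + 1), p ^ i) :
    GammaDeg.P p k i = GammaDeg.basis p k 1 ⟨i, h⟩ := by
  refine GammaDeg.ext fun m => ?_
  rw [GammaDeg.basis_apply]
  rfl

theorem IsogRing.sum_P (w : IsogRing p k 1) :
    w = ∑ i : Fin (p + 1), algebraMap k⟦X⟧ _ (GammaDeg.P p k i w) *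
      IsogRing.x₁ p k 1 ^ (i : ℕ) := by
  have hc : p + 1 = ∑ i ∈ Finset.range (1 + 1), p ^ i := by
    rw [Finset.sum_range_succ, Finset.sum_range_one, pow_zero, pow_one, add_comm]
  conv_lhs => rw [IsogRing.sum_basis w]
  exact (Fintype.sum_equiv (finCongr hc) _ _ fun i => by rw [GammaDeg.P_eq i (hc ▸ i.2)]; rfl).symm

theorem GammaDeg.sum_P (φ : GammaDeg p k 1) :
    φ = ∑ i : Fin (p + 1), φ (IsogRing.x₁ p k 1 ^ (i : ℕ)) • GammaDeg.P p k i := by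
  have hc : p + 1 = ∑ i ∈ Finset.range (1 + 1), p ^ i := by
    rw [Finset.sum_range_succ, Finset.sum_range_one, pow_zero, pow_one, add_comm]
  conv_lhs => rw [← GammaDeg.sum_basis φ]
  exact (Fintype.sum_equiv (finCongr hc) _ _ fun i => by rw [GammaDeg.P_eq i (hc ▸ i.2)]; rfl).symm

theorem GammaDeg.P_algebraMap {i : Fin (p + 1)} (hi : i ≠ 0) (a : k⟦X⟧) :
    GammaDeg.P p k i (algebraMap k⟦X⟧ _ a) = 0 := by
  have hc : p + 1 = ∑ i ∈ Finset.range (1 + 1), p ^ i := by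
    rw [Finset.sum_range_succ, Finset.sum_range_one, pow_zero, pow_one, add_comm]
  have h := GammaDeg.basis_x₁_pow (p := p) (k := k) (r := 1) ⟨i, hc ▸ i.2⟩ ⟨0, by omega⟩
  have hne : ¬ (0 : ℕ) = i := fun h0 => hi (Fin.ext h0.symm)
  rw [pow_zero, ← GammaDeg.P_eq] at h
  simp only [Fin.mk.injEq, hne, if_false] at h
  rw [Algebra.algebraMap_eq_smul_one, map_smul, h, smul_zero]

/-- The relations between the generators of `Γ`. They hold because the passage to the dual isogeny
is an automorphism of `A_1` that interchanges `s` and `t` on the powers of `x`. -/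
theorem GammaDeg.sum_X_pow_smul_mul {i : Fin (p + 1)} (hi : i ≠ 0) :
    ∑ j : Fin (p + 1), (PowerSeries.X : k⟦X⟧) ^ (j : ℕ) •
      GammaDeg.mul p k (GammaDeg.P p k i) (GammaDeg.P p k j) = 0 := by
  -- `ρ` is well defined because exchanging the variables permutes the two factors of `F_p` up to
  -- signs that cancel.
  let ρ : IsogRing p k 1 →+* IsogRing p k 1 := IsogRing.lift p k 1 (IsogRing.target p k 1)
    (algebraMap k⟦X⟧ _ PowerSeries.X) (by
      rw [target_X]
      have h := crossing_x₁ p k 1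
      simp only [crossing, Finset.prod_range_succ, Finset.prod_range_zero, pow_zero, pow_one,
        Nat.sub_self, Nat.sub_zero] at h ⊢
      linear_combination h)
  refine GammaDeg.ext_x₁ fun n => ?_
  have h := congrArg ρ (IsogRing.sum_P (IsogRing.x₁ p k 1 ^ n))
  simp only [map_sum, map_mul, map_pow, ρ, IsogRing.lift_x₁, IsogRing.lift_algebraMap] at h
  simp only [← map_pow] at h
  -- Here `h` reads `x₀^n = ∑_j t(P_j(x₁^n)) x₀^j`. The left side lies in the image of `s`, where
  -- `P_i` vanishes; on the right, `P_i(t(P_j(x₁^n)))` is the value of `P_i P_j` on `x₁^n`.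
  have h' := congrArg (GammaDeg.P p k i) h
  rw [GammaDeg.P_algebraMap hi] at h'
  rw [map_sum] at h'
  refine Eq.trans ?_ h'.symm
  rw [GammaDeg.sum_apply]
  refine Finset.sum_congr rfl fun j _ => ?_
  rw [GammaDeg.smul_apply, GammaDeg.mul_x₁_pow, mul_comm (IsogRing.target p k 1 _),
    ← Algebra.smul_def, map_smul, smul_eq_mul]

end Dual

/-! ### Counting admissible sequences -/

section Admissible

variable {p : ℕ}

theorem admissible_zero (r : ℕ) : Admissible (0 : Fin r → Fin (p + 1)) :=
  fun _ _ _ h => absurd rfl h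

/-- A zero forces the entry before it to be zero, so a final zero propagates back to the start. -/
theorem Admissible.eq_zero {r : ℕ} {I : Fin (r + 1) → Fin (p + 1)} (hI : Admissible I)
    (h : I (Fin.last r) = 0) : I = 0 := by
  have key : ∀ (n : ℕ) (i : Fin (r + 1)), (i : ℕ) + n = r → I i = 0 := by
    intro n
    induction n with
    | zero => intro i hi; rwa [show i = Fin.last r from Fin.ext hi]
    | succ n ih =>
      intro i hi
      by_contra hne
      exact hI i ⟨i + 1, by omega⟩ rfl hne (ih _ (by simp only; omega))
  funext i
  exact key (r - i) i (by omega)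

theorem Admissible.init {r : ℕ} {I : Fin (r + 1) → Fin (p + 1)} (hI : Admissible I) :
    Admissible fun i : Fin r => I i.castSucc :=
  fun i j hij => hI i.castSucc j.castSucc hij

theorem Admissible.of_init {r : ℕ} {I : Fin (r + 1) → Fin (p + 1)}
    (hI : Admissible fun i : Fin r => I i.castSucc) (h : I (Fin.last r) ≠ 0) : Admissible I := by
  intro i j hij hi
  induction j using Fin.lastCases with
  | last => exact h
  | cast j =>
    obtain ⟨i, rfl⟩ : ∃ i' : Fin r, i = i'.castSucc :=
      ⟨⟨i, by have := j.2; simp at hij; omega⟩, rfl⟩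
    exact hI i j hij hi

/-- An admissible sequence of length `r + 1` is zero, or it is obtained from an admissible sequence
of length `r` by appending a nonzero entry. -/
noncomputable def admissibleSuccEquiv (r : ℕ) :
    {I : Fin (r + 1) → Fin (p + 1) // Admissible I} ≃
      Option ({I : Fin r → Fin (p + 1) // Admissible I} × Fin p) where
  toFun I := if h : I.1 (Fin.last r) = 0 then none else
    some (⟨_, I.2.init⟩, (I.1 (Fin.last r)).pred h)
  invFun o := o.elim ⟨0, admissible_zero _⟩ fun K =>
    ⟨Fin.snoc (α := fun _ => Fin (p + 1)) K.1.1 K.2.succ,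
      Admissible.of_init (by simpa using K.1.2) (by simp)⟩
  left_inv I := by
    by_cases h : I.1 (Fin.last r) = 0
    · simp only [h, dite_true, Option.elim_none]
      exact Subtype.ext (I.2.eq_zero h).symm
    · simp only [h, dite_false, Option.elim_some]
      refine Subtype.ext ?_
      simp only [Fin.succ_pred]
      exact Fin.snoc_init_self I.1
  right_inv o := by
    cases o with
    | none => simp
    | some K => simp

/-- The recursion is `N_{r+1} = p N_r + 1`: one of `p` nonzero entries is appended, or the sequence
is zero. -/
theorem card_admissible (r : ℕ) :
    Nat.card {I : Fin r → Fin (p + 1) // Admissible I} = ∑ i ∈ Finset.range (r + 1), p ^ i := by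
  induction r with
  | zero =>
    have : Unique {I : Fin 0 → Fin (p + 1) // Admissible I} :=
      ⟨⟨⟨0, admissible_zero _⟩⟩, fun I => Subtype.ext (Subsingleton.elim _ _)⟩
    simp
  | succ r ih =>
    rw [Nat.card_congr (admissibleSuccEquiv r), Finite.card_option, Nat.card_prod, ih,
      Nat.card_eq_fintype_card, Fintype.card_fin, Finset.sum_range_succ' _ (r + 1), Finset.sum_mul]
    simp [pow_succ]

end Admissible

/-! ### Rewriting words into admissible words -/

section Words

variable {p : ℕ} {A D : Type*} [Ring A] [Ring D] (β : A →+* D) (P : Fin (p + 1) → D)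

/-- The product `P_{i_1} ⋯ P_{i_r}`. -/
def word {r : ℕ} (I : Fin r → Fin (p + 1)) : D := (List.ofFn fun j => P (I j)).prod

theorem word_succ {r : ℕ} (I : Fin (r + 1) → Fin (p + 1)) :
    word P I = word P (fun i : Fin r => I i.castSucc) * P (I (Fin.last r)) := by
  rw [word, List.ofFn_succ', List.concat_eq_append, List.prod_append, List.prod_singleton, word]

/-- The left `A`-span of the words of length `r`. -/
def wordSpan (r : ℕ) : AddSubgroup D :=
  AddSubgroup.closure {t | ∃ (a : A) (I : Fin r → Fin (p + 1)), t = β a * word P I}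

/-- The left `A`-span of the admissible words of length `r`. -/
def admissibleSpan (r : ℕ) : AddSubgroup D :=
  AddSubgroup.closure
    {t | ∃ (a : A) (I : Fin r → Fin (p + 1)), Admissible I ∧ t = β a * word P I}

variable {β P}

theorem closure_le_comap {G H : Type*} [AddCommGroup G] [AddCommGroup H] {s : Set G}
    {K : AddSubgroup H} (f : G →+ H) (h : ∀ x ∈ s, f x ∈ K) {x : G}
    (hx : x ∈ AddSubgroup.closure s) : f x ∈ K :=
  (AddSubgroup.closure_le (K.comap f)).mpr h hx

theorem word_mem_wordSpan {r : ℕ} (I : Fin r → Fin (p + 1)) : word P I ∈ wordSpan β P r :=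
  AddSubgroup.subset_closure ⟨1, I, by simp⟩

theorem mul_mem_wordSpan (a : A) {r : ℕ} {t : D} (ht : t ∈ wordSpan β P r) :
    β a * t ∈ wordSpan β P r :=
  closure_le_comap (AddMonoidHom.mulLeft (β a)) (by
    rintro _ ⟨b, I, rfl⟩
    exact AddSubgroup.subset_closure ⟨a * b, I, by simp [mul_assoc]⟩) ht

theorem wordSpan_mul_mem (i : Fin (p + 1)) {r : ℕ} {t : D} (ht : t ∈ wordSpan β P r) :
    t * P i ∈ wordSpan β P (r + 1) :=
  closure_le_comap (AddMonoidHom.mulRight (P i)) (by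
    rintro _ ⟨b, I, rfl⟩
    exact AddSubgroup.subset_closure ⟨b, Fin.snoc (α := fun _ => Fin (p + 1)) I i, by
      simp [word_succ, mul_assoc]⟩) ht

/-- The scalar is moved left one letter at a time. Letters may change on the way, so admissibility
can be lost; hence the statement is about all words. -/
theorem wordSpan_mul_base_mem (hcomm : ∀ i a, ∃ c : Fin (p + 1) → A, P i * β a = ∑ j, β (c j) * P j)
    (a : A) {r : ℕ} {t : D} (ht : t ∈ wordSpan β P r) : t * β a ∈ wordSpan β P r := by
  induction r generalizing t a with
  | zero =>
    refine closure_le_comap (AddMonoidHom.mulRight (β a)) ?_ ht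
    rintro _ ⟨b, I, rfl⟩
    exact AddSubgroup.subset_closure ⟨b * a, I, by simp [word]⟩
  | succ r ih =>
    refine closure_le_comap (AddMonoidHom.mulRight (β a)) ?_ ht
    rintro _ ⟨b, I, rfl⟩
    obtain ⟨c, hc⟩ := hcomm (I (Fin.last r)) a
    rw [AddMonoidHom.mulRight_apply, word_succ, mul_assoc, mul_assoc, hc, Finset.mul_sum,
      Finset.mul_sum]
    refine AddSubgroup.sum_mem _ fun j _ => mul_mem_wordSpan _ ?_
    rw [← mul_assoc]
    exact wordSpan_mul_mem _ (ih _ (word_mem_wordSpan _))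

theorem mul_mem_admissibleSpan (a : A) {r : ℕ} {t : D} (ht : t ∈ admissibleSpan β P r) :
    β a * t ∈ admissibleSpan β P r :=
  closure_le_comap (AddMonoidHom.mulLeft (β a)) (by
    rintro _ ⟨b, I, hI, rfl⟩
    exact AddSubgroup.subset_closure ⟨a * b, I, hI, by simp [mul_assoc]⟩) ht

theorem admissibleSpan_mul_mem {i : Fin (p + 1)} (hi : i ≠ 0) {r : ℕ} {t : D}
    (ht : t ∈ admissibleSpan β P r) : t * P i ∈ admissibleSpan β P (r + 1) :=
  closure_le_comap (AddMonoidHom.mulRight (P i)) (by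
    rintro _ ⟨b, I, hI, rfl⟩
    exact AddSubgroup.subset_closure ⟨b, Fin.snoc (α := fun _ => Fin (p + 1)) I i,
      Admissible.of_init (by simpa using hI) (by simpa using hi), by
        simp [word_succ, mul_assoc]⟩) ht

/-- If `A` can be moved to the left past the `P_i`, and if the products `P_i P_0` with `i ≠ 0`
can be rewritten as combinations of the products `P_i P_j` with `j ≠ 0`, then all words are
combinations of admissible words. -/
theorem wordSpan_le_admissibleSpan
    (hcomm : ∀ i a, ∃ c : Fin (p + 1) → A, P i * β a = ∑ j, β (c j) * P j)
    (c : Fin (p + 1) → A)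
    (hrel : ∀ i ≠ 0, P i * P 0 = ∑ j : Fin p, β (c j.succ) * P i * P j.succ) (r : ℕ) :
    wordSpan β P r ≤ admissibleSpan β P r := by
  induction r with
  | zero =>
    refine AddSubgroup.closure_mono ?_
    rintro _ ⟨a, I, rfl⟩
    exact ⟨a, I, fun i => i.elim0, rfl⟩
  | succ r ih =>
    refine (AddSubgroup.closure_le _).mpr ?_
    rintro _ ⟨a, I, rfl⟩
    refine mul_mem_admissibleSpan _ ?_
    rw [word_succ]
    have hI : word P (fun i : Fin r => I i.castSucc) ∈ admissibleSpan β P r :=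
      ih (word_mem_wordSpan _)
    by_cases h : I (Fin.last r) = 0
    · rw [h]
      refine closure_le_comap (AddMonoidHom.mulRight (P 0)) ?_ hI
      rintro _ ⟨b, K, hK, rfl⟩
      rw [AddMonoidHom.mulRight_apply, mul_assoc]
      refine mul_mem_admissibleSpan _ ?_
      -- A nonzero admissible `K` ends in a nonzero letter, so the relation applies to that letter
      -- followed by `P 0`.
      by_cases hK0 : K = 0
      · exact AddSubgroup.subset_closure ⟨1, 0, admissible_zero _, by
          rw [word_succ, map_one, one_mul, hK0]; rfl⟩
      · cases r with
        | zero => exact absurd (Subsingleton.elim _ _) hK0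
        | succ r =>
          rw [word_succ, mul_assoc, hrel _ fun h0 => hK0 (hK.eq_zero h0), Finset.mul_sum]
          refine AddSubgroup.sum_mem _ fun j _ => ?_
          rw [← mul_assoc, ← mul_assoc]
          -- The scalar now stands inside the word. Once moved left, everything before `P j.succ` is
          -- a combination of words of the shorter length, to which induction applies; appending the
          -- nonzero letter keeps admissibility.
          refine admissibleSpan_mul_mem (Fin.succ_ne_zero j) (ih (wordSpan_mul_mem _ ?_))
          exact wordSpan_mul_base_mem hcomm _ (word_mem_wordSpan _)
    · exact admissibleSpan_mul_mem h hI

end Words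

/-! ### The tensor algebra: universal property and graded pieces -/

section TensorRing

variable (R : Type*) [CommRing R] (M : Type*) [AddCommGroup M] [Module R M] [Module Rᵐᵒᵖ M]
  [SMulCommClass R Rᵐᵒᵖ M]

/-- `TensorRing.ofBase` as a ring homomorphism. -/
noncomputable def TensorRing.baseHom : R →+* TensorRing R M :=
  RingHom.mk' ⟨⟨TensorRing.ofBase M, (RingQuot.mkRingHom_rel .base_one).trans (map_one _)⟩,
      fun a b => (RingQuot.mkRingHom_rel (.base_mul a b)).trans (map_mul _ _ _)⟩
    fun a b => (RingQuot.mkRingHom_rel (.base_add a b)).trans (map_add _ _ _)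

/-- `TensorRing.ofModule` as an additive homomorphism. -/
noncomputable def TensorRing.moduleHom : M →+ TensorRing R M :=
  AddMonoidHom.mk' (TensorRing.ofModule R)
    fun m n => (RingQuot.mkRingHom_rel (.add m n)).trans (map_add _ _ _)

variable {R M}

theorem TensorRing.ofModule_smul (a : R) (m : M) : TensorRing.ofModule R (a • m) =
    TensorRing.ofBase M a * TensorRing.ofModule R m :=
  (RingQuot.mkRingHom_rel (.left_smul a m)).trans (map_mul _ _ _)

theorem TensorRing.ofModule_op_smul (a : R) (m : M) :
    TensorRing.ofModule R (MulOpposite.op a • m) =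
      TensorRing.ofModule R m * TensorRing.ofBase M a :=
  (RingQuot.mkRingHom_rel (.right_smul m a)).trans (map_mul _ _ _)

/-- The universal property of `T_R(M)`. -/
noncomputable def TensorRing.lift {B : Type*} [Ring B] (f : R →+* B) (g : M →+ B)
    (hl : ∀ a m, g (a • m) = f a * g m) (hr : ∀ a m, g (MulOpposite.op a • m) = g m * f a) :
    TensorRing R M →+* B :=
  RingQuot.lift ⟨(FreeAlgebra.lift ℤ (Sum.elim f g) : FreeAlgebra ℤ (R ⊕ M) →+* B), by
    intro x y h
    induction h <;> simp [hl, hr]⟩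

theorem TensorRing.lift_ofBase {B : Type*} [Ring B] (f : R →+* B) (g : M →+ B)
    (hl : ∀ a m, g (a • m) = f a * g m) (hr : ∀ a m, g (MulOpposite.op a • m) = g m * f a)
    (a : R) : TensorRing.lift f g hl hr (TensorRing.ofBase M a) = f a := by
  refine (RingQuot.lift_mkRingHom_apply _ _ _).trans ?_
  simp

theorem TensorRing.lift_ofModule {B : Type*} [Ring B] (f : R →+* B) (g : M →+ B)
    (hl : ∀ a m, g (a • m) = f a * g m) (hr : ∀ a m, g (MulOpposite.op a • m) = g m * f a)
    (m : M) : TensorRing.lift f g hl hr (TensorRing.ofModule R m) = g m := by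
  refine (RingQuot.lift_mkRingHom_apply _ _ _).trans ?_
  simp

theorem TensorRing.ofBase_mul_mem (a : R) {r : ℕ} {t : TensorRing R M}
    (ht : t ∈ TensorRing.degreePart R M r) :
    TensorRing.ofBase M a * t ∈ TensorRing.degreePart R M r :=
  closure_le_comap (AddMonoidHom.mulLeft (TensorRing.ofBase M a)) (by
    rintro _ ⟨b, m, rfl⟩
    exact AddSubgroup.subset_closure ⟨a * b, m, by
      rw [AddMonoidHom.coe_mulLeft, ← mul_assoc]
      exact congrArg (· * _) (map_mul (TensorRing.baseHom R M) a b).symm⟩) ht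

theorem TensorRing.mul_ofModule_mem (m : M) {r : ℕ} {t : TensorRing R M}
    (ht : t ∈ TensorRing.degreePart R M r) :
    t * TensorRing.ofModule R m ∈ TensorRing.degreePart R M (r + 1) :=
  closure_le_comap (AddMonoidHom.mulRight (TensorRing.ofModule R m)) (by
    rintro _ ⟨b, n, rfl⟩
    refine AddSubgroup.subset_closure ⟨b, Fin.snoc (α := fun _ => M) n m, ?_⟩
    rw [AddMonoidHom.mulRight_apply, List.ofFn_succ', List.concat_eq_append, List.prod_append,
      List.prod_singleton, mul_assoc]
    simp) ht

/-- The last factor absorbs the scalar through the right action; in degree `0` the coefficient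
absorbs it. -/
theorem TensorRing.mul_ofBase_mem (a : R) {r : ℕ} {t : TensorRing R M}
    (ht : t ∈ TensorRing.degreePart R M r) :
    t * TensorRing.ofBase M a ∈ TensorRing.degreePart R M r := by
  refine closure_le_comap (AddMonoidHom.mulRight (TensorRing.ofBase M a)) ?_ ht
  rintro _ ⟨b, n, rfl⟩
  rw [AddMonoidHom.mulRight_apply, mul_assoc]
  cases r with
  | zero =>
    refine AddSubgroup.subset_closure ⟨b * a, n, ?_⟩
    simp only [List.ofFn_zero, List.prod_nil, one_mul, mul_one]
    exact (map_mul (TensorRing.baseHom R M) b a).symm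
  | succ r =>
    refine AddSubgroup.subset_closure ⟨b, Fin.snoc (α := fun _ => M) (Fin.init n)
      (MulOpposite.op a • n (Fin.last r)), ?_⟩
    rw [List.ofFn_succ', List.concat_eq_append, List.prod_append, List.prod_singleton,
      List.ofFn_succ', List.concat_eq_append, List.prod_append, List.prod_singleton,
      Fin.snoc_last, TensorRing.ofModule_op_smul, mul_assoc]
    simp [Fin.init]

theorem TensorRing.one_mem : (1 : TensorRing R M) ∈ TensorRing.degreePart R M 0 :=
  AddSubgroup.subset_closure ⟨1, Fin.elim0, by
    rw [List.ofFn_zero, List.prod_nil, mul_one]; exact (map_one (TensorRing.baseHom R M)).symm⟩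

/-- The graded pieces span `T_R(M)`. -/
theorem TensorRing.eq_top_of_degreePart_le (H : AddSubgroup (TensorRing R M))
    (hH : ∀ r, TensorRing.degreePart R M r ≤ H) : H = ⊤ := by
  let G := ⨆ r, TensorRing.degreePart R M r
  let π : FreeAlgebra ℤ (R ⊕ M) →+* TensorRing R M := RingQuot.mkRingHom (TensorRing.Rel R M)
  -- Since `1` lies in the sum `G` of the pieces, stability of `G` under right multiplication is
  -- enough. It can be checked on generators of the free algebra; directness of the sum plays no
  -- role.
  suffices h : ∀ x, ∀ t ∈ G, t * π x ∈ G by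
    refine eq_top_iff.mpr fun t _ => iSup_le hH ?_
    obtain ⟨x, rfl⟩ := RingQuot.mkRingHom_surjective (TensorRing.Rel R M) t
    have := h x 1 (AddSubgroup.mem_iSup_of_mem 0 TensorRing.one_mem)
    rwa [one_mul] at this
  intro x
  induction x with
  | grade0 n =>
    intro t ht
    rw [eq_intCast, map_intCast]
    rw [← zsmul_eq_mul']
    exact AddSubgroup.zsmul_mem _ ht n
  | grade1 x =>
    intro t ht
    refine AddSubgroup.iSup_induction _ (C := fun t => t * π (FreeAlgebra.ι ℤ x) ∈ G) ht
      (fun r t ht => ?_) ?_ fun u v hu hv => ?_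
    · cases x with
      | inl a => exact AddSubgroup.mem_iSup_of_mem r (TensorRing.mul_ofBase_mem a ht)
      | inr m => exact AddSubgroup.mem_iSup_of_mem (r + 1) (TensorRing.mul_ofModule_mem m ht)
    · rw [zero_mul]
      exact AddSubgroup.zero_mem _
    · rw [add_mul]
      exact AddSubgroup.add_mem _ hu hv
  | mul x y hx hy =>
    intro t ht
    rw [map_mul, ← mul_assoc]
    exact hy _ (hx _ ht)
  | add x y hx hy =>
    intro t ht
    rw [map_add, mul_add]
    exact AddSubgroup.add_mem _ (hx _ ht) (hy _ ht)

end TensorRing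

/-! ### The map from the tensor algebra onto `Γ` -/

section GammaRing

variable {p : ℕ} [hp : Fact p.Prime] {k : Type*} [Field k] [CharP k p]

theorem Gamma.of_mul_of {r r' : ℕ} (φ : GammaDeg p k r) (ψ : GammaDeg p k r') :
    DirectSum.of (GammaDeg p k) r φ * DirectSum.of (GammaDeg p k) r' ψ =
      DirectSum.of (GammaDeg p k) (r + r') (GammaDeg.mul p k φ ψ) :=
  DirectSum.of_mul_of φ ψ

theorem Gamma.smul_of {r : ℕ} (a : k⟦X⟧) (φ : GammaDeg p k r) :
    a • DirectSum.of (GammaDeg p k) r φ = DirectSum.of (GammaDeg p k) r (a • φ) :=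
  (DirectSum.of_smul k⟦X⟧ r a φ).symm

theorem Gamma.smul_one (a : k⟦X⟧) : a • (1 : Gamma p k) =
    DirectSum.of (GammaDeg p k) 0 (a • GammaDeg.one p k) :=
  Gamma.smul_of a _

/-- This and its right-hand counterpart `Gamma.of_mul_smul_one` identify multiplication by `a • 1`
with the bimodule actions, which is what the universal property of the tensor algebra requires. -/
theorem Gamma.smul_one_mul_of {r : ℕ} (a : k⟦X⟧) (φ : GammaDeg p k r) :
    a • (1 : Gamma p k) * DirectSum.of (GammaDeg p k) r φ =
      DirectSum.of (GammaDeg p k) r (a • φ) := by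
  rw [Gamma.smul_one, Gamma.of_mul_of]
  refine DirectSum.of_eq_of_gradedMonoid_eq (GammaDeg.sigma_ext (zero_add r) fun j => ?_)
  rw [GammaDeg.mul_x₁_pow, GammaDeg.smul_apply, GammaDeg.one_target, GammaDeg.smul_apply]

theorem Gamma.of_mul_smul_one {r : ℕ} (a : k⟦X⟧) (φ : GammaDeg p k r) :
    DirectSum.of (GammaDeg p k) r φ * a • (1 : Gamma p k) =
      DirectSum.of (GammaDeg p k) r (MulOpposite.op a • φ) := by
  rw [Gamma.smul_one, Gamma.of_mul_of]
  refine DirectSum.of_eq_of_gradedMonoid_eq (GammaDeg.sigma_ext (add_zero r) fun j => ?_)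
  rw [GammaDeg.mul_x₁_pow, GammaDeg.smul_apply, GammaDeg.one_x₁_pow, GammaDeg.op_smul_apply,
    MulOpposite.unop_op, mul_comm, map_mul, map_pow, target_X]

variable (p k)

/-- The ring homomorphism `A → Γ`, an isomorphism onto `Γ_0`. -/
noncomputable def Gamma.baseHom : k⟦X⟧ →+* Gamma p k :=
  RingHom.mk' ⟨⟨fun a => a • (1 : Gamma p k), one_smul _ _⟩, fun a b => by
    change (a * b) • (1 : Gamma p k) = a • (1 : Gamma p k) * b • (1 : Gamma p k)
    rw [Gamma.smul_one b, Gamma.smul_one_mul_of, Gamma.smul_one, mul_smul]⟩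
    fun a b => add_smul a b (1 : Gamma p k)

/-- The ring homomorphism from the tensor algebra of `Γ_1` to `Γ`. -/
noncomputable def Gamma.ofTensorRing : TensorRing k⟦X⟧ (GammaDeg p k 1) →+* Gamma p k :=
  TensorRing.lift (Gamma.baseHom p k) (DirectSum.of (GammaDeg p k) 1)
    (fun a φ => (Gamma.smul_one_mul_of a φ).symm) (fun a φ => (Gamma.of_mul_smul_one a φ).symm)

variable {p k}

theorem Gamma.ofTensorRing_ofBase (a : k⟦X⟧) :
    Gamma.ofTensorRing p k (TensorRing.ofBase _ a) = a • (1 : Gamma p k) :=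
  TensorRing.lift_ofBase _ _ _ _ a

theorem Gamma.ofTensorRing_ofModule (φ : GammaDeg p k 1) :
    Gamma.ofTensorRing p k (TensorRing.ofModule _ φ) = DirectSum.of (GammaDeg p k) 1 φ :=
  TensorRing.lift_ofModule _ _ _ _ φ

theorem Gamma.ofTensorRing_relator {i : Fin (p + 1)} (hi : i ≠ 0) :
    Gamma.ofTensorRing p k (relator p k i) = 0 := by
  rw [relator, map_sum]
  simp only [map_mul, Gamma.ofTensorRing_ofBase, Gamma.ofTensorRing_ofModule]
  have h : ∀ j : Fin (p + 1), (PowerSeries.X : k⟦X⟧) ^ (j : ℕ) • (1 : Gamma p k) *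
      DirectSum.of (GammaDeg p k) 1 (GammaDeg.P p k i) *
      DirectSum.of (GammaDeg p k) 1 (GammaDeg.P p k j) =
      DirectSum.of (GammaDeg p k) (1 + 1) ((PowerSeries.X : k⟦X⟧) ^ (j : ℕ) •
        GammaDeg.mul p k (GammaDeg.P p k i) (GammaDeg.P p k j)) := fun j => by
    rw [mul_assoc, Gamma.of_mul_of, Gamma.smul_one_mul_of]
  rw [Finset.sum_congr rfl fun j _ => h j, ← map_sum, GammaDeg.sum_X_pow_smul_mul hi, map_zero]

theorem Gamma.ofTensorRing_degreePart {r : ℕ} {t : TensorRing k⟦X⟧ (GammaDeg p k 1)}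
    (ht : t ∈ TensorRing.degreePart k⟦X⟧ (GammaDeg p k 1) r) :
    Gamma.ofTensorRing p k t ∈ (DirectSum.of (GammaDeg p k) r).range := by
  refine closure_le_comap (Gamma.ofTensorRing p k).toAddMonoidHom ?_ ht
  rintro _ ⟨a, m, rfl⟩
  suffices h : ∃ φ, Gamma.ofTensorRing p k (List.ofFn fun i => TensorRing.ofModule k⟦X⟧ (m i)).prod =
      DirectSum.of (GammaDeg p k) r φ by
    obtain ⟨φ, hφ⟩ := h
    refine ⟨a • φ, ?_⟩
    rw [← Gamma.smul_one_mul_of, ← hφ, ← Gamma.ofTensorRing_ofBase, ← map_mul]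
    rfl
  clear ht
  induction r with
  | zero => exact ⟨GammaDeg.one p k, by rw [List.ofFn_zero, List.prod_nil, map_one]; rfl⟩
  | succ r ih =>
    obtain ⟨φ, hφ⟩ := ih (fun i => m i.castSucc)
    refine ⟨GammaDeg.mul p k φ (m (Fin.last r)), ?_⟩
    rw [List.ofFn_succ', List.concat_eq_append, List.prod_append, List.prod_singleton, map_mul,
      hφ, Gamma.ofTensorRing_ofModule, Gamma.of_mul_of]

/-- `Γ` is generated by `Γ_1` over `A`. -/
theorem Gamma.exists_degreePart {r : ℕ} (φ : GammaDeg p k r) :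
    ∃ t ∈ TensorRing.degreePart k⟦X⟧ (GammaDeg p k 1) r,
      Gamma.ofTensorRing p k t = DirectSum.of (GammaDeg p k) r φ := by
  induction r with
  | zero =>
    refine ⟨TensorRing.ofBase _ (φ 1) * 1, TensorRing.ofBase_mul_mem _ TensorRing.one_mem, ?_⟩
    rw [mul_one, Gamma.ofTensorRing_ofBase, Gamma.smul_one]
    congr 1
    have h0 : 0 < ∑ i ∈ Finset.range (0 + 1), p ^ i := by simp
    -- `Γ_0` has rank one, so an element is determined by its value at `1`; the unit of `Γ` takes
    -- the value `1` there.
    have h1 : ∀ ψ : GammaDeg p k 0, ψ = ψ 1 • GammaDeg.basis p k 0 ⟨0, h0⟩ := fun ψ => by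
      conv_lhs => rw [← GammaDeg.sum_basis ψ]
      refine (Fintype.sum_eq_single ⟨0, h0⟩ fun j hj => absurd (Fin.ext ?_) hj).trans (by
        rw [pow_zero])
      have := j.2
      simp only [zero_add, Finset.sum_range_one, pow_zero] at this
      exact Nat.lt_one_iff.mp this
    have h2 := GammaDeg.one_x₁_pow (p := p) (k := k) 0
    rw [pow_zero, pow_zero] at h2
    rw [h1 (GammaDeg.one p k), h2, one_smul, ← h1]
  | succ r ih =>
    have hφ : φ ∈ Submodule.span k⟦X⟧ {θ : GammaDeg p k (r + 1) |
      ∃ (φ : GammaDeg p k r) (ψ : GammaDeg p k 1), θ = GammaDeg.mul p k φ ψ} := by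
      rw [GammaDeg.span_mul]; trivial
    induction hφ using Submodule.span_induction with
    | mem _ h =>
      obtain ⟨φ, ψ, rfl⟩ := h
      obtain ⟨t, ht, h⟩ := ih φ
      refine ⟨t * TensorRing.ofModule _ ψ, TensorRing.mul_ofModule_mem ψ ht, ?_⟩
      rw [map_mul, h, Gamma.ofTensorRing_ofModule, Gamma.of_mul_of]
    | zero => exact ⟨0, AddSubgroup.zero_mem _, by rw [map_zero, map_zero]⟩
    | add φ ψ _ _ hφ hψ =>
      obtain ⟨t, ht, h⟩ := hφ
      obtain ⟨u, hu, h'⟩ := hψ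
      exact ⟨t + u, AddSubgroup.add_mem _ ht hu, by rw [map_add, map_add, h, h']⟩
    | smul a φ _ hφ =>
      obtain ⟨t, ht, h⟩ := hφ
      refine ⟨_, TensorRing.ofBase_mul_mem a ht, ?_⟩
      rw [map_mul, h, Gamma.ofTensorRing_ofBase, Gamma.smul_one_mul_of]

end GammaRing

/-! ### Spanning `Δ` by admissible words, and the map `Δ → Γ` -/

section DeltaRing

variable (p : ℕ) [hp : Fact p.Prime] (k : Type*) [Field k] [CharP k p]

/-- The ring homomorphism `A → Δ`. -/
noncomputable def Delta.baseHom : k⟦X⟧ →+* Delta p k :=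
  (Delta.mk p k).comp (TensorRing.baseHom _ _)

/-- The images of the `P_i` in `Δ`. -/
noncomputable def Delta.P (i : Fin (p + 1)) : Delta p k :=
  Delta.mk p k (TensorRing.ofModule _ (GammaDeg.P p k i))

variable {p k}

theorem Delta.mk_relator {i : Fin (p + 1)} (hi : i ≠ 0) : Delta.mk p k (relator p k i) = 0 := by
  have h : relator p k i ∈ relationIdeal p k := TwoSidedIdeal.subset_span ⟨i, hi, rfl⟩
  rw [← TwoSidedIdeal.ker_ringCon_mk' (relationIdeal p k), TwoSidedIdeal.mem_ker] at h
  exact h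

/-- The `P_j` generate `Γ_1` on the left. Applied to `P_i · a`, this gives the rule for moving
scalars to the left of the `P_i` in `Δ`. -/
theorem Delta.mk_ofModule (φ : GammaDeg p k 1) : Delta.mk p k (TensorRing.ofModule _ φ) =
    ∑ j : Fin (p + 1), Delta.baseHom p k (φ (IsogRing.x₁ p k 1 ^ (j : ℕ))) * Delta.P p k j := by
  conv_lhs => rw [GammaDeg.sum_P φ]
  refine (map_sum ((Delta.mk p k).toAddMonoidHom.comp (TensorRing.moduleHom _ _)) _ _).trans ?_
  refine Finset.sum_congr rfl fun j _ => ?_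
  exact (congrArg (Delta.mk p k) (TensorRing.ofModule_smul _ _)).trans (map_mul _ _ _)

theorem Delta.P_mul_baseHom (i : Fin (p + 1)) (a : k⟦X⟧) : ∃ c : Fin (p + 1) → k⟦X⟧,
    Delta.P p k i * Delta.baseHom p k a = ∑ j, Delta.baseHom p k (c j) * Delta.P p k j :=
  ⟨_, ((map_mul (Delta.mk p k) _ _).symm.trans
    (congrArg (Delta.mk p k) (TensorRing.ofModule_op_smul a _).symm)).trans
    (Delta.mk_ofModule (MulOpposite.op a • GammaDeg.P p k i))⟩

/-- The coefficient of `P_i P_0` in the relator is `x^0 = 1`, so the relation can be solved for this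
product. -/
theorem Delta.P_mul_P_zero {i : Fin (p + 1)} (hi : i ≠ 0) :
    Delta.P p k i * Delta.P p k 0 = ∑ j : Fin p,
      Delta.baseHom p k (-PowerSeries.X ^ (j.succ : ℕ)) * Delta.P p k i * Delta.P p k j.succ := by
  have h := Delta.mk_relator (k := k) hi
  rw [relator, map_sum] at h
  simp only [map_mul] at h
  change ∑ j : Fin (p + 1), Delta.baseHom p k (PowerSeries.X ^ (j : ℕ)) * Delta.P p k i *
    Delta.P p k j = 0 at h
  rw [Fin.sum_univ_succ, Fin.val_zero, pow_zero, map_one, one_mul] at h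
  rw [eq_neg_of_add_eq_zero_left h, ← Finset.sum_neg_distrib]
  simp only [map_neg, neg_mul]

theorem Delta.wordSpan_le (r : ℕ) : wordSpan (Delta.baseHom p k) (Delta.P p k) r ≤
    admissibleSpan (Delta.baseHom p k) (Delta.P p k) r :=
  wordSpan_le_admissibleSpan (β := Delta.baseHom p k) (P := Delta.P p k) Delta.P_mul_baseHom
    (fun j => -PowerSeries.X ^ (j : ℕ))
    (fun _ hi => Delta.P_mul_P_zero hi) r

theorem Delta.mk_mem_admissibleSpan {r : ℕ} {t : TensorRing k⟦X⟧ (GammaDeg p k 1)}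
    (ht : t ∈ TensorRing.degreePart k⟦X⟧ (GammaDeg p k 1) r) :
    Delta.mk p k t ∈ admissibleSpan (Delta.baseHom p k) (Delta.P p k) r := by
  refine Delta.wordSpan_le r (closure_le_comap (Delta.mk p k).toAddMonoidHom ?_ ht)
  rintro _ ⟨a, m, rfl⟩
  suffices h : Delta.mk p k (List.ofFn fun i => TensorRing.ofModule k⟦X⟧ (m i)).prod ∈
      wordSpan (Delta.baseHom p k) (Delta.P p k) r by
    have h2 := mul_mem_wordSpan a h
    refine Eq.mp (congrArg (· ∈ _) ?_) h2
    exact (map_mul (Delta.mk p k) _ _).symm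
  clear ht
  induction r with
  | zero =>
    rw [List.ofFn_zero, List.prod_nil, map_one]
    exact word_mem_wordSpan (β := Delta.baseHom p k) (P := Delta.P p k) Fin.elim0
  | succ r ih =>
    rw [List.ofFn_succ', List.concat_eq_append, List.prod_append, List.prod_singleton, map_mul,
      Delta.mk_ofModule, Finset.mul_sum]
    refine AddSubgroup.sum_mem _ fun j _ => ?_
    rw [← mul_assoc]
    exact wordSpan_mul_mem _ (wordSpan_mul_base_mem Delta.P_mul_baseHom _ (ih _))

variable (p k)

/-- The ring homomorphism `Δ → Γ`. -/
noncomputable def Delta.toGamma : Delta p k →+* Gamma p k :=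
  RingCon.lift _ (Gamma.ofTensorRing p k) (by
    have h : relationIdeal p k ≤ TwoSidedIdeal.ker (Gamma.ofTensorRing p k) := by
      refine TwoSidedIdeal.span_le.mpr ?_
      rintro _ ⟨i, hi, rfl⟩
      exact (TwoSidedIdeal.mem_ker _).mpr (Gamma.ofTensorRing_relator hi)
    exact fun _ _ hxy => TwoSidedIdeal.ringCon_le_iff.mp h hxy)

variable {p k}

theorem Delta.toGamma_mk (t : TensorRing k⟦X⟧ (GammaDeg p k 1)) :
    Delta.toGamma p k (Delta.mk p k t) = Gamma.ofTensorRing p k t := rfl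

theorem Delta.mk_surjective : Function.Surjective (Delta.mk p k) :=
  RingCon.mk'_surjective _

theorem Delta.toGamma_baseHom_mul {r : ℕ} (a : k⟦X⟧) {d : Delta p k} {φ : GammaDeg p k r}
    (h : Delta.toGamma p k d = DirectSum.of (GammaDeg p k) r φ) :
    Delta.toGamma p k (Delta.baseHom p k a * d) = DirectSum.of (GammaDeg p k) r (a • φ) := by
  rw [map_mul, h, ← Gamma.smul_one_mul_of, ← Gamma.ofTensorRing_ofBase, ← Delta.toGamma_mk]
  rfl

theorem Delta.toGamma_word {r : ℕ} (I : Fin r → Fin (p + 1)) :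
    Delta.toGamma p k (word (Delta.P p k) I) = Gamma.monomial k I := by
  rw [word, map_list_prod, List.map_ofFn, Gamma.monomial]
  congr 2
  funext j
  exact Gamma.ofTensorRing_ofModule _

end DeltaRing

/-! ### Bases of `Γ_r` and bijectivity -/

section Basis

/-- A surjection between finite free modules of equal rank over a commutative ring is bijective. -/
theorem exists_basis_of_span_eq_top {R M ι : Type*} [CommRing R] [Nontrivial R] [AddCommGroup M]
    [Module R M] [Module.Finite R M]
    [Module.Free R M] [Finite ι] (v : ι → M)
    (hv : Submodule.span R (Set.range v) = ⊤) (hc : Nat.card ι = Module.finrank R M) :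
    ∃ b : Module.Basis ι R M, ∀ i, b i = v i := by
  have := Fintype.ofFinite ι
  have hs : Function.Surjective (Finsupp.linearCombination R v) := by
    rw [← LinearMap.range_eq_top, Finsupp.range_linearCombination, hv]
  have hb := OrzechProperty.bijective_of_surjective_of_finrank_le _ hs (by
    rw [Module.finrank_finsupp_self, ← hc, Nat.card_eq_fintype_card])
  exact ⟨.ofRepr (LinearEquiv.ofBijective _ hb).symm, fun i => by
    rw [Module.Basis.coe_ofRepr]
    simp⟩

variable {p : ℕ} [hp : Fact p.Prime] {k : Type*} [Field k] [CharP k p]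

theorem Gamma.exists_of_eq_monomial {r : ℕ} (I : Fin r → Fin (p + 1)) :
    ∃ φ, DirectSum.of (GammaDeg p k) r φ = Gamma.monomial k I := by
  induction r with
  | zero => exact ⟨GammaDeg.one p k, by rw [Gamma.monomial, List.ofFn_zero, List.prod_nil]; rfl⟩
  | succ r ih =>
    obtain ⟨φ, hφ⟩ := ih fun i => I i.castSucc
    refine ⟨GammaDeg.mul p k φ (GammaDeg.P p k (I (Fin.last r))), ?_⟩
    rw [← Gamma.of_mul_of, hφ]
    exact (word_succ (fun i => DirectSum.of (GammaDeg p k) 1 (GammaDeg.P p k i)) I).symm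

/-- The admissible monomials of length `r` form a basis of `Γ_r`. -/
theorem Gamma.exists_admissible_basis (r : ℕ) :
    ∃ b : Module.Basis {I : Fin r → Fin (p + 1) // Admissible I} k⟦X⟧ (GammaDeg p k r),
      ∀ I, DirectSum.of (GammaDeg p k) r (b I) = Gamma.monomial k I.1 := by
  choose v hv using fun I : Fin r → Fin (p + 1) => Gamma.exists_of_eq_monomial (k := k) I
  suffices h : Submodule.span k⟦X⟧
      (Set.range fun I : {I : Fin r → Fin (p + 1) // Admissible I} => v I.1) = ⊤ by
    obtain ⟨b, hb⟩ := exists_basis_of_span_eq_top _ h (by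
      rw [card_admissible, GammaDeg.finrank])
    exact ⟨b, fun I => by rw [hb, hv]⟩
  refine eq_top_iff.mpr fun φ _ => ?_
  -- Spanning is inherited from `Δ`: `φ` lifts to the tensor algebra, and the image of the lift in
  -- `Δ` is a combination of admissible words.
  obtain ⟨t, ht, htφ⟩ := Gamma.exists_degreePart φ
  have hK : Delta.toGamma p k (Delta.mk p k t) ∈ (Submodule.span k⟦X⟧ (Set.range
      fun I : {I : Fin r → Fin (p + 1) // Admissible I} => v I.1)).toAddSubgroup.map
        (DirectSum.of (GammaDeg p k) r) := by
    refine closure_le_comap (Delta.toGamma p k).toAddMonoidHom ?_ (Delta.mk_mem_admissibleSpan ht)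
    rintro _ ⟨a, I, hI, rfl⟩
    exact ⟨a • v I, Submodule.smul_mem _ _ (Submodule.subset_span ⟨⟨I, hI⟩, rfl⟩),
      (Delta.toGamma_baseHom_mul a ((Delta.toGamma_word I).trans (hv I).symm)).symm⟩
  obtain ⟨ψ, hψ, h⟩ := hK
  rw [Delta.toGamma_mk, htφ] at h
  exact DirectSum.of_injective (β := GammaDeg p k) r h ▸ hψ

theorem Delta.toGamma_injective : Function.Injective (Delta.toGamma p k) := by
  classical
  choose b hb using Gamma.exists_admissible_basis (p := p) (k := k)
  have (r : ℕ) := Fintype.ofFinite {I : Fin r → Fin (p + 1) // Admissible I}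
  -- The candidate left inverse sends each admissible monomial back to the same word in `Δ`.
  -- Additivity is enough, since the admissible words with coefficients generate `Δ` as an additive
  -- group.
  let η : Gamma p k →+ Delta p k := DirectSum.toAddMonoid fun r => AddMonoidHom.mk'
    (fun φ => ∑ I, Delta.baseHom p k ((b r).repr φ I) * word (Delta.P p k) I.1) fun φ ψ => by
      simp only [map_add, Finsupp.add_apply, add_mul, Finset.sum_add_distrib]
  have hη : ∀ (r : ℕ) (a : k⟦X⟧) (I : {I : Fin r → Fin (p + 1) // Admissible I}),
      η (DirectSum.of (GammaDeg p k) r (a • b r I)) =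
        Delta.baseHom p k a * word (Delta.P p k) I.1 := by
    intro r a I
    refine (DirectSum.toAddMonoid_of _ _ _).trans ?_
    rw [AddMonoidHom.mk'_apply, Finset.sum_eq_single I]
    · simp
    · intro J _ hJ
      simp [Finsupp.single_eq_of_ne hJ]
    · exact fun h => absurd (Finset.mem_univ _) h
  -- The locus where `η` inverts the map is pulled back to the tensor algebra, where it suffices to
  -- treat one degree at a time.
  have hH := TensorRing.eq_top_of_degreePart_le
    (((η.comp (Delta.toGamma p k).toAddMonoidHom).eqLocus (AddMonoidHom.id _)).comap
      (Delta.mk p k).toAddMonoidHom) fun r t ht => by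
    change Delta.mk p k t ∈ (η.comp (Delta.toGamma p k).toAddMonoidHom).eqLocus (AddMonoidHom.id _)
    refine (AddSubgroup.closure_le _).mpr ?_ (Delta.mk_mem_admissibleSpan ht)
    rintro _ ⟨a, I, hI, rfl⟩
    exact (congrArg η (Delta.toGamma_baseHom_mul a
      ((Delta.toGamma_word I).trans (hb r ⟨I, hI⟩).symm))).trans (hη r a ⟨I, hI⟩)
  refine Function.LeftInverse.injective (g := η) fun d => ?_
  obtain ⟨t, rfl⟩ := Delta.mk_surjective d
  exact (SetLike.ext_iff.mp hH t).mpr trivial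

theorem Delta.toGamma_surjective : Function.Surjective (Delta.toGamma p k) := by
  intro x
  induction x using DirectSum.induction_on with
  | zero => exact ⟨0, map_zero _⟩
  | of r φ =>
    obtain ⟨t, _, ht⟩ := Gamma.exists_degreePart φ
    exact ⟨Delta.mk p k t, ht⟩
  | add x y hx hy =>
    obtain ⟨u, rfl⟩ := hx
    obtain ⟨v, rfl⟩ := hy
    exact ⟨u + v, map_add _ _ _⟩

end Basis

end Isogeny

theorem mainTheorem3 (p : ℕ) [Fact p.Prime] (k : Type*) [Field k] [CharP k p]
    (hk : Nat.card k = p ^ 2) :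
    (∃ ζ : Delta p k ≃+* Gamma p k,
      (∀ a : PowerSeries k, ζ (Delta.mk p k (TensorRing.ofBase _ a)) = a • (1 : Gamma p k)) ∧
      (∀ φ : GammaDeg p k 1, ζ (Delta.mk p k (TensorRing.ofModule _ φ)) =
        DirectSum.of (GammaDeg p k) 1 φ) ∧
      (∀ r : ℕ, (fun t => ζ (Delta.mk p k t)) ''
          (TensorRing.degreePart k⟦X⟧ (GammaDeg p k 1) r) =
        Set.range (DirectSum.of (GammaDeg p k) r))) ∧
    (∀ r : ℕ,
      (∃ b : Module.Basis {I : Fin r → Fin (p + 1) // Admissible I} k⟦X⟧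
          (GammaDeg p k r),
        ∀ I, DirectSum.of (GammaDeg p k) r (b I) = Gamma.monomial k I.1) ∧
      Nat.card {I : Fin r → Fin (p + 1) // Admissible I} = ∑ i ∈ Finset.range (r + 1), p ^ i) := by
  refine ⟨⟨RingEquiv.ofBijective (Delta.toGamma p k)
    ⟨Delta.toGamma_injective, Delta.toGamma_surjective⟩, Gamma.ofTensorRing_ofBase,
    Gamma.ofTensorRing_ofModule, fun r => ?_⟩,
    fun r => ⟨Gamma.exists_admissible_basis r, card_admissible r⟩⟩
  ext x
  constructor
  · rintro ⟨t, ht, rfl⟩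
    exact Gamma.ofTensorRing_degreePart ht
  · rintro ⟨φ, rfl⟩
    exact Gamma.exists_degreePart φ
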